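/- For $x\in\mathbb C$ and $n\in\mathbb N$ let $(x)_n=x(x+1)\cdots(x+n-1)$, and for complex $a$ let $(x)_a=\Gamma(x+a)/\Gamma(x)$. For complex $a\notin\{-1,-2,-3,\dots\}$ the series $$f(a)=\sum_{n=0}^{\infty}\frac1{2^{6n}}\,\frac{\left(a+\frac12\right)_n^3}{(a+1)_n^3}\,[42(n+a)+5]$$ converges, and the following hold. (i) If $\operatorname{Re} a>0$, then the series on the right converges and $$f(a)=32a\sum_{n=0}^{\infty}\frac{\left(a+\frac12\right)_n^2}{(2a+1)_n^2}.$$ (ii) If $\operatorname{Re} a<\frac12$ and $2a\notin\{-1,-2,-3,\dots\}$, then the series on the right converges and $$f(a)=\frac{16}{\pi}\cdot\frac{64^a}{\cos^2\pi a}\cdot\frac{(1)_a^3}{\left(\frac12\right)_a^3}+\frac{128a^2}{2a-1}\sum_{n=0}^{\infty}\frac{\left(a+\frac12\right)_n^2}{(2a+1)_n\left(\frac32-a\right)_n}.$$ (iii) $f\left(\frac12\right)=\frac{8\pi^2}{3}$ and $f(0)=\frac{16}{\pi}$; moreover $f$ is analytic at $0$, with $f'(0)=\frac{192}{\pi}\ln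 2$ and $f''(0)=\frac{16}{\pi}\left(144\ln^2 2-7\pi^2\right)$. -/

import Mathlib

/-- The rising factorial `(x)_n = x (x + 1) ⋯ (x + n - 1)` with a natural index `n`. -/
noncomputable def rising (x : ℂ) (n : ℕ) : ℂ := (ascPochhammer ℂ n).eval x

/-- The rising factorial `(x)_a = Γ(x + a) / Γ(x)` with a complex index `a`. -/
noncomputable def risingGamma (x a : ℂ) : ℂ := Complex.Gamma (x + a) / Complex.Gamma x

/-- The `n`-th term of the extended Ramanujan series. -/
noncomputable def ramanujanTerm (a : ℂ) (n : ℕ) : ℂ :=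
  1 / 2 ^ (6 * n) * (rising (a + 1 / 2) n ^ 3 / rising (a + 1) n ^ 3) * (42 * ((n : ℂ) + a) + 5)

/-- The extended Ramanujan series `f(a)`. -/
noncomputable def ramanujanF (a : ℂ) : ℂ := ∑' n : ℕ, ramanujanTerm a n

/-- The `n`-th term of the series in the first identity. -/
noncomputable def firstTerm (a : ℂ) (n : ℕ) : ℂ :=
  rising (a + 1 / 2) n ^ 2 / rising (2 * a + 1) n ^ 2

/-- The `n`-th term of the series in the second identity. -/
noncomputable def secondTerm (a : ℂ) (n : ℕ) : ℂ :=
  rising (a + 1 / 2) n ^ 2 / (rising (2 * a + 1) n * rising (3 / 2 - a) n)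

section

open Filter Topology Complex

/-! The first identity is a Wilf–Zeilberger summation. The pair `wzF`, `wzG` satisfies F(n+1,k) −
F(n,k) = G(n,k+1) − G(n,k) (`wz_pair`), with G(n,0) the n-th term of f and F(0,k) equal to 32a times
the k-th term of the first companion series. Summing over a rectangle and letting its sides grow
leaves the two boundary sums, provided F tends to 0 in n and the sums of G over n tend to 0 in k.
Both limits come from writing the common factor of F and G as 4^(-n), times a ratio of norm at most
1, times the square of a quotient of Beta integrals (`weight_mul_halfRatio_sq`); the Beta quotient
gives decay in k uniformly in n.

The second identity follows from the first by a relation between two ₃F₂(1) series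
(`tsum_hypTerm_add_tsum_hypTerm`). To prove it, split B(p,q) at t into two incomplete Beta
integrals, expand each as a power series, multiply by t^(q-1) (1-t)^(p-1) and integrate over (0,1):
the left side becomes B(p,q)² and each series integrates termwise to a hypergeometric one. The
choice p = 2a, q = 1/2 − a turns these into the two companion series, and the duplication and
reflection formulas turn the Beta quotient into the Gamma term. This covers 0 < Re a < 1/2; both
sides are holomorphic on the larger domain, so the identity theorem extends it.

At a = 1/2 the first companion series is ζ(2). Near 0 the second identity reads f(a) = g(a) + a²
k(a), with g the Gamma term. Hence f(0) and f'(0) are those of g, while f''(0) = g''(0) + 2k(0),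
where k(0) comes from the arcsine series at 1. The value g''(0) is found without second derivatives
of Γ: reflection makes g(a) g(-a) elementary (`gammaPart_mul_gammaPart_neg`), and its second
derivative at 0 determines g''(0) from g(0) and g'(0). -/

/-! ### Rising factorials and the Gamma function -/

theorem rising_zero (x : ℂ) : rising x 0 = 1 := by simp [rising]

theorem rising_succ (x : ℂ) (n : ℕ) : rising x (n + 1) = rising x n * (x + n) := by
  simp [rising, ascPochhammer_succ_eval]

theorem continuous_rising (n : ℕ) : Continuous fun x => rising x n :=
  (ascPochhammer ℂ n).continuous

theorem differentiable_rising (n : ℕ) : Differentiable ℂ fun x => rising x n :=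
  (ascPochhammer ℂ n).differentiable

theorem rising_ne_zero {x : ℂ} (hx : ∀ m : ℕ, x + m ≠ 0) (n : ℕ) : rising x n ≠ 0 := by
  induction n with
  | zero => simp [rising_zero]
  | succ n ih => rw [rising_succ]; exact mul_ne_zero ih (hx n)

theorem add_natCast_ne_zero_of_re_pos {x : ℂ} (hx : 0 < x.re) (m : ℕ) : x + m ≠ 0 := by
  intro h
  have := congrArg Complex.re h
  simp at this
  have : (0 : ℝ) ≤ m := Nat.cast_nonneg m
  linarith

theorem rising_ne_zero_of_re_pos {x : ℂ} (hx : 0 < x.re) (n : ℕ) : rising x n ≠ 0 :=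
  rising_ne_zero (add_natCast_ne_zero_of_re_pos hx) n

theorem rising_add (x : ℂ) (n k : ℕ) : rising x (n + k) = rising x n * rising (x + n) k := by
  induction k with
  | zero => simp [rising_zero]
  | succ k ih => rw [← add_assoc, rising_succ, rising_succ, ih]; push_cast; ring

theorem rising_shift (x : ℂ) (k : ℕ) : rising (x + 1) k * x = rising x k * (x + k) := by
  have := rising_add x 1 k
  rw [add_comm 1 k, rising_succ, rising_succ, rising_zero] at this
  rw [this]; push_cast; ring

theorem rising_two_mul (x : ℂ) (n : ℕ) :
    rising (2 * x) (2 * n) = 4 ^ n * rising x n * rising (x + 1 / 2) n := by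
  induction n with
  | zero => simp [rising_zero]
  | succ n ih =>
    rw [show 2 * (n + 1) = 2 * n + 1 + 1 by ring, rising_succ, rising_succ, ih, rising_succ,
      rising_succ]
    push_cast; ring

theorem rising_one (n : ℕ) : rising 1 n = (n.factorial : ℂ) := by
  simp [rising, ascPochhammer_eval_one]

theorem Gamma_add_natCast {x : ℂ} (hx : ∀ m : ℕ, x + m ≠ 0) (n : ℕ) :
    Complex.Gamma (x + n) = rising x n * Complex.Gamma x := by
  induction n with
  | zero => simp [rising_zero]
  | succ n ih =>
    rw [rising_succ]; push_cast
    rw [← add_assoc, Complex.Gamma_add_one _ (hx n), ih]; ring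

/-! ### Beta integrals and their norms -/

theorem betaIntegral_eq_Gamma {u v : ℂ} (hu : 0 < u.re) (hv : 0 < v.re) :
    betaIntegral u v = Gamma u * Gamma v / Gamma (u + v) := by
  rw [Gamma_mul_Gamma_eq_betaIntegral hu hv, mul_div_cancel_left₀]
  exact Gamma_ne_zero_of_re_pos (by simp; linarith)

theorem betaIntegral_ne_zero {u v : ℂ} (hu : 0 < u.re) (hv : 0 < v.re) :
    betaIntegral u v ≠ 0 := by
  rw [betaIntegral_eq_Gamma hu hv]
  exact div_ne_zero (mul_ne_zero (Gamma_ne_zero_of_re_pos hu) (Gamma_ne_zero_of_re_pos hv))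
    (Gamma_ne_zero_of_re_pos (by simp; linarith))

theorem betaIntegral_add_natCast {u v : ℂ} (hu : 0 < u.re) (hv : 0 < v.re) (i j : ℕ) :
    betaIntegral (u + i) (v + j) =
      betaIntegral u v * (rising u i * rising v j / rising (u + v) (i + j)) := by
  have huv : 0 < (u + v).re := by simp; linarith
  have hi : (0 : ℝ) ≤ i := Nat.cast_nonneg i
  have hj : (0 : ℝ) ≤ j := Nat.cast_nonneg j
  rw [betaIntegral_eq_Gamma hu hv, betaIntegral_eq_Gamma (by simp; linarith) (by simp; linarith),
    show u + i + (v + j) = (u + v) + ((i + j : ℕ) : ℂ) by push_cast; ring,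
    Gamma_add_natCast (add_natCast_ne_zero_of_re_pos hu),
    Gamma_add_natCast (add_natCast_ne_zero_of_re_pos hv),
    Gamma_add_natCast (add_natCast_ne_zero_of_re_pos huv)]
  have h1 := Gamma_ne_zero_of_re_pos huv
  have h2 := rising_ne_zero_of_re_pos huv (i + j)
  field_simp

theorem norm_betaIntegrand (u v : ℂ) {x : ℝ} (hx : 0 < x) (hx1 : x < 1) :
    ‖(x : ℂ) ^ (u - 1) * (1 - (x : ℂ)) ^ (v - 1)‖ = x ^ (u.re - 1) * (1 - x) ^ (v.re - 1) := by
  rw [norm_mul, norm_cpow_eq_rpow_re_of_pos hx,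
    show (1 - (x : ℂ)) = ((1 - x : ℝ) : ℂ) by push_cast; rfl,
    norm_cpow_eq_rpow_re_of_pos (by linarith)]
  simp

theorem betaIntegral_ofReal (u v : ℝ) :
    betaIntegral u v = ((∫ x : ℝ in 0..1, x ^ (u - 1) * (1 - x) ^ (v - 1) : ℝ) : ℂ) := by
  rw [betaIntegral, ← intervalIntegral.integral_ofReal]
  apply intervalIntegral.integral_congr
  intro x hx
  rw [Set.uIcc_of_le zero_le_one] at hx
  have h1 : 0 ≤ 1 - x := by linarith [hx.2]
  simp only [ofReal_mul]
  rw [ofReal_cpow hx.1, ofReal_cpow h1]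
  push_cast; rfl

theorem intervalIntegrable_real_betaIntegrand {u v : ℝ} (hu : 0 < u) (hv : 0 < v) :
    IntervalIntegrable (fun x : ℝ => x ^ (u - 1) * (1 - x) ^ (v - 1)) MeasureTheory.volume 0 1 := by
  have h := (betaIntegral_convergent (u := u) (v := v) (by simpa) (by simpa)).norm
  refine h.congr_ae ?_
  rw [Set.uIoc_of_le zero_le_one, ← MeasureTheory.restrict_Ioo_eq_restrict_Ioc]
  filter_upwards [MeasureTheory.ae_restrict_mem measurableSet_Ioo] with x hx
  simpa using norm_betaIntegrand u v hx.1 hx.2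

theorem integral_norm_betaIntegrand (u v : ℂ) :
    ∫ x : ℝ in 0..1, ‖(x : ℂ) ^ (u - 1) * (1 - (x : ℂ)) ^ (v - 1)‖ =
      ∫ x : ℝ in 0..1, x ^ (u.re - 1) * (1 - x) ^ (v.re - 1) := by
  rw [intervalIntegral.integral_of_le zero_le_one, intervalIntegral.integral_of_le zero_le_one,
    MeasureTheory.integral_Ioc_eq_integral_Ioo, MeasureTheory.integral_Ioc_eq_integral_Ioo]
  exact MeasureTheory.setIntegral_congr_fun measurableSet_Ioo
    fun x hx => norm_betaIntegrand u v hx.1 hx.2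

theorem norm_betaIntegral_ofReal (u v : ℝ) :
    ‖betaIntegral u v‖ = ∫ x : ℝ in 0..1, x ^ (u - 1) * (1 - x) ^ (v - 1) := by
  rw [betaIntegral_ofReal, norm_real, Real.norm_of_nonneg]
  apply intervalIntegral.integral_nonneg zero_le_one
  intro x hx
  have h1 : 0 ≤ 1 - x := by linarith [hx.2]
  have := hx.1
  positivity

/-- On (0,1) the norm of the integrand depends only on the real parts and decreases as they grow.
This later removes the index n from a Beta integral, giving bounds uniform in n. -/
theorem norm_betaIntegral_le {u v : ℂ} {u₀ v₀ : ℝ} (hu₀ : 0 < u₀) (hv₀ : 0 < v₀)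
    (hu : u₀ ≤ u.re) (hv : v₀ ≤ v.re) : ‖betaIntegral u v‖ ≤ ‖betaIntegral u₀ v₀‖ := by
  rw [norm_betaIntegral_ofReal]
  refine (intervalIntegral.norm_integral_le_integral_norm zero_le_one).trans ?_
  rw [integral_norm_betaIntegrand]
  refine intervalIntegral.integral_mono_on_of_le_Ioo zero_le_one
    (intervalIntegrable_real_betaIntegrand (by linarith) (by linarith))
    (intervalIntegrable_real_betaIntegrand hu₀ hv₀) fun x hx => ?_
  have h1 : 0 < 1 - x := by linarith [hx.2]
  have h0 := hx.1
  refine mul_le_mul (Real.rpow_le_rpow_of_exponent_ge h0 hx.2.le (by linarith))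
    (Real.rpow_le_rpow_of_exponent_ge h1 (by linarith) (by linarith)) (by positivity)
    (by positivity)

/-! ### Uniform convergence of ₃F₂ series at 1 -/

/-- The `n`-th term of the hypergeometric series `₃F₂(x₁, x₂, 1; y₁, y₂; 1)`. -/
noncomputable def hypTerm (x₁ x₂ y₁ y₂ : ℂ) (n : ℕ) : ℂ :=
  rising x₁ n * rising x₂ n / (rising y₁ n * rising y₂ n)

theorem hypTerm_succ (x₁ x₂ y₁ y₂ : ℂ) (n : ℕ) :
    hypTerm x₁ x₂ y₁ y₂ (n + 1) =
      hypTerm x₁ x₂ y₁ y₂ n * ((x₁ + n) * (x₂ + n) / ((y₁ + n) * (y₂ + n))) := by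
  simp only [hypTerm, rising_succ]
  rw [div_mul_div_comm]
  congr 1 <;> ring

/-- A Raabe-type estimate: with excess σ = y₁ + y₂ − x₁ − x₂, the term ratio is 1 − σ/n + O(1/n²).
Half of the margin 2ε in Re σ absorbs the error. The threshold N depends only on R and ε, which
makes the later bounds uniform on compact sets. -/
theorem exists_norm_mul_le_of_excess {R ε : ℝ} (hR : 0 ≤ R) (hε : 0 < ε) :
    ∃ N : ℕ, ∀ x₁ x₂ y₁ y₂ : ℂ, ‖x₁‖ ≤ R → ‖x₂‖ ≤ R → ‖y₁‖ ≤ R → ‖y₂‖ ≤ R →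
      1 + 2 * ε ≤ (y₁ + y₂ - x₁ - x₂).re → ∀ n : ℕ, N ≤ n →
      ‖(x₁ + n) * (x₂ + n)‖ ≤ (1 - (1 + ε) / (n + 1)) * ‖(y₁ + n) * (y₂ + n)‖ := by
  -- The three summands serve separately: n ≥ 4R keeps n + Re X at least n/2, n ≥ ε makes
  -- (1+ε)/(n+1) at most 1, and the quotient by ε makes nε dominate the accumulated errors 6R² +
  -- 2R(1+ε).
  obtain ⟨N, hN⟩ := exists_nat_ge (4 * R + ε + (6 * R ^ 2 + 2 * R * (1 + ε)) / ε)
  refine ⟨N, fun x₁ x₂ y₁ y₂ hx₁ hx₂ hy₁ hy₂ hs n hn => ?_⟩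
  have hn' : 4 * R + ε + (6 * R ^ 2 + 2 * R * (1 + ε)) / ε ≤ n :=
    hN.trans (by exact_mod_cast hn)
  have hq : 0 ≤ (6 * R ^ 2 + 2 * R * (1 + ε)) / ε := by positivity
  have hn1 : 4 * R ≤ n := by linarith
  have hn2 : ε ≤ n := by linarith
  have hn3 : 6 * R ^ 2 + 2 * R * (1 + ε) ≤ n * ε := by
    rw [← div_le_iff₀ hε]; linarith
  have hn0 : (0 : ℝ) ≤ n := Nat.cast_nonneg n
  have hX : ‖x₁ + x₂‖ ≤ 2 * R := (norm_add_le _ _).trans (by linarith)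
  have hY : ‖y₁ + y₂‖ ≤ 2 * R := (norm_add_le _ _).trans (by linarith)
  have hXX : ‖x₁ * x₂‖ ≤ R ^ 2 := by
    rw [norm_mul, sq]; exact mul_le_mul hx₁ hx₂ (norm_nonneg _) hR
  have hYY : ‖y₁ * y₂‖ ≤ R ^ 2 := by
    rw [norm_mul, sq]; exact mul_le_mul hy₁ hy₂ (norm_nonneg _) hR
  set X := x₁ + x₂
  set Y := y₁ + y₂
  have hs' : 1 + 2 * ε ≤ Y.re - X.re := by
    have : (y₁ + y₂ - x₁ - x₂).re = Y.re - X.re := by simp [X, Y]; ring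
    linarith
  have hXre := (abs_re_le_norm X).trans hX
  have hXim := (abs_im_le_norm X).trans hX
  have hYre := (abs_re_le_norm Y).trans hY
  rw [abs_le] at hXre hXim hYre
  have h1 : n * ‖(n : ℂ) + X‖ ≤ n * (n + X.re) + 4 * R ^ 2 := by
    have h0 : 0 ≤ n * (n + X.re) + 4 * R ^ 2 := by
      have : 0 ≤ n + X.re := by linarith
      positivity
    refine abs_le_of_sq_le_sq' ?_ h0 |>.2
    rw [mul_pow, ← normSq_eq_norm_sq, normSq_apply]
    simp only [add_re, natCast_re, add_im, natCast_im, zero_add]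
    have him : X.im * X.im ≤ 4 * R ^ 2 := by nlinarith
    have h2 : (n : ℝ) ^ 2 * (X.im * X.im) ≤ n ^ 2 * (4 * R ^ 2) := by gcongr
    have h3 : (n : ℝ) * (4 * R ^ 2) ≤ 8 * R ^ 2 * (n + X.re) := by nlinarith [sq_nonneg R]
    nlinarith [mul_le_mul_of_nonneg_left h3 hn0, sq_nonneg (4 * R ^ 2)]
  have hA : ‖(x₁ + n) * (x₂ + n)‖ ≤ n * (n + X.re) + 5 * R ^ 2 := by
    have : (x₁ + n) * (x₂ + n) = n * (n + X) + x₁ * x₂ := by simp only [X]; ring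
    rw [this]
    refine (norm_add_le _ _).trans ?_
    rw [norm_mul, norm_natCast]
    linarith
  have hB : n * (n + Y.re) - R ^ 2 ≤ ‖(y₁ + n) * (y₂ + n)‖ := by
    have : (y₁ + n) * (y₂ + n) = n * (n + Y) - -(y₁ * y₂) := by simp only [Y]; ring
    rw [this]
    refine le_trans ?_ (norm_sub_norm_le _ _)
    rw [norm_mul, norm_natCast, norm_neg]
    have : (n : ℝ) + Y.re ≤ ‖(n : ℂ) + Y‖ := by
      simpa using re_le_norm ((n : ℂ) + Y)
    nlinarith
  set c := (1 + ε) / ((n : ℝ) + 1)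
  have hc : c * (n + 1) = 1 + ε := by
    simp only [c]; field_simp
  have hc0 : 0 ≤ c := by positivity
  have hc1 : c ≤ 1 := by
    simp only [c]; rw [div_le_one (by positivity)]; linarith
  refine hA.trans (le_trans ?_ (mul_le_mul_of_nonneg_left hB (by linarith)))
  have h4 : c * (n * (n + Y.re) - R ^ 2) ≤ (1 + ε) * (n + 2 * R) := by
    calc c * (n * (n + Y.re) - R ^ 2) ≤ c * (n * (n + 2 * R)) := by
          gcongr; nlinarith [sq_nonneg R]
      _ = (c * n) * (n + 2 * R) := by ring
      _ ≤ (1 + ε) * (n + 2 * R) := by gcongr; linarith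
  nlinarith

/-- Past N, the norm of the n-th term times (n+1)^(1+ε) does not increase, because Bernoulli's
inequality compares the ratio bound with ((n+1)/(n+2))^(1+ε). The finitely many earlier terms are
bounded on K by compactness. -/
theorem exists_norm_hypTerm_le {K : Set ℂ} (hK : IsCompact K) {x₁ x₂ y₁ y₂ : ℂ → ℂ}
    (hx₁ : ContinuousOn x₁ K) (hx₂ : ContinuousOn x₂ K) (hy₁ : ContinuousOn y₁ K)
    (hy₂ : ContinuousOn y₂ K) (h₁ : ∀ a ∈ K, ∀ m : ℕ, y₁ a + m ≠ 0)
    (h₂ : ∀ a ∈ K, ∀ m : ℕ, y₂ a + m ≠ 0) {ε : ℝ} (hε : 0 < ε)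
    (hs : ∀ a ∈ K, 1 + 2 * ε ≤ (y₁ a + y₂ a - x₁ a - x₂ a).re) :
    ∃ C : ℝ, ∀ a ∈ K, ∀ n : ℕ,
      ‖hypTerm (x₁ a) (x₂ a) (y₁ a) (y₂ a) n‖ ≤ C / ((n : ℝ) + 1) ^ (1 + ε) := by
  obtain ⟨R₁, hR₁⟩ := hK.exists_bound_of_continuousOn hx₁
  obtain ⟨R₂, hR₂⟩ := hK.exists_bound_of_continuousOn hx₂
  obtain ⟨R₃, hR₃⟩ := hK.exists_bound_of_continuousOn hy₁
  obtain ⟨R₄, hR₄⟩ := hK.exists_bound_of_continuousOn hy₂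
  obtain ⟨N, hN⟩ := exists_norm_mul_le_of_excess (R := |R₁| + |R₂| + |R₃| + |R₄|)
    (by positivity) hε
  have hb : ∀ n : ℕ, ∃ C : ℝ, ∀ a ∈ K,
      ‖hypTerm (x₁ a) (x₂ a) (y₁ a) (y₂ a) n‖ * ((n : ℝ) + 1) ^ (1 + ε) ≤ C := by
    intro n
    have hc : ContinuousOn (fun a => hypTerm (x₁ a) (x₂ a) (y₁ a) (y₂ a) n) K := by
      unfold hypTerm
      refine ContinuousOn.div ?_ ?_ fun a ha => mul_ne_zero (rising_ne_zero (h₁ a ha) n)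
        (rising_ne_zero (h₂ a ha) n)
      · exact ((continuous_rising n).comp_continuousOn hx₁).mul
          ((continuous_rising n).comp_continuousOn hx₂)
      · exact ((continuous_rising n).comp_continuousOn hy₁).mul
          ((continuous_rising n).comp_continuousOn hy₂)
    obtain ⟨C, hC⟩ := hK.exists_bound_of_continuousOn hc
    exact ⟨C * ((n : ℝ) + 1) ^ (1 + ε), fun a ha =>
      mul_le_mul_of_nonneg_right (hC a ha) (by positivity)⟩
  choose B hB using hb
  refine ⟨∑ i ∈ Finset.range (N + 1), |B i|, fun a ha n => ?_⟩
  rw [le_div_iff₀ (by positivity)]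
  have hle : ∀ i ≤ N, ‖hypTerm (x₁ a) (x₂ a) (y₁ a) (y₂ a) i‖ * ((i : ℝ) + 1) ^ (1 + ε) ≤
      ∑ i ∈ Finset.range (N + 1), |B i| := fun i hi =>
    ((hB i a ha).trans (le_abs_self _)).trans <|
      Finset.single_le_sum (f := fun i => |B i|) (fun _ _ => abs_nonneg _)
        (Finset.mem_range.2 (by omega))
  rcases le_or_gt n N with hn | hn
  · exact hle n hn
  induction n, hn.le using Nat.le_induction with
  | base => exact hle N le_rfl
  | succ n hn' ih =>
    have ih' : ‖hypTerm (x₁ a) (x₂ a) (y₁ a) (y₂ a) n‖ * ((n : ℝ) + 1) ^ (1 + ε) ≤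
        ∑ i ∈ Finset.range (N + 1), |B i| := by
      rcases hn'.lt_or_eq with h | h
      · exact ih h
      · exact hle n h.ge
    refine le_trans ?_ ih'
    have key := hN (x₁ a) (x₂ a) (y₁ a) (y₂ a)
      (by linarith [hR₁ a ha, le_abs_self R₁, abs_nonneg R₂, abs_nonneg R₃, abs_nonneg R₄])
      (by linarith [hR₂ a ha, le_abs_self R₂, abs_nonneg R₁, abs_nonneg R₃, abs_nonneg R₄])
      (by linarith [hR₃ a ha, le_abs_self R₃, abs_nonneg R₁, abs_nonneg R₂, abs_nonneg R₄])
      (by linarith [hR₄ a ha, le_abs_self R₄, abs_nonneg R₁, abs_nonneg R₂, abs_nonneg R₃])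
      (hs a ha) n hn'
    have hpos : 0 < ‖(y₁ a + n) * (y₂ a + n)‖ :=
      norm_pos_iff.2 (mul_ne_zero (h₁ a ha n) (h₂ a ha n))
    have hratio : ‖(x₁ a + n) * (x₂ a + n) / ((y₁ a + n) * (y₂ a + n))‖ ≤
        1 - (1 + ε) / (n + 1) := by
      rw [norm_div, div_le_iff₀ hpos]; exact key
    have hbern : 1 - (1 + ε) / ((n : ℝ) + 1) ≤
        ((n : ℝ) + 1) ^ (1 + ε) / ((n : ℝ) + 1 + 1) ^ (1 + ε) := by
      rw [← Real.div_rpow (by positivity) (by positivity)]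
      have h := one_add_mul_self_le_rpow_one_add (s := -(1 / ((n : ℝ) + 1 + 1))) (p := 1 + ε)
        (by rw [neg_le_neg_iff, div_le_one (by positivity)]; linarith [Nat.cast_nonneg (α := ℝ) n])
        (by linarith)
      have e : 1 + -(1 / ((n : ℝ) + 1 + 1)) = ((n : ℝ) + 1) / ((n : ℝ) + 1 + 1) := by
        field_simp; ring
      rw [e] at h
      refine le_trans ?_ h
      have : (1 + ε) / ((n : ℝ) + 1 + 1) ≤ (1 + ε) / ((n : ℝ) + 1) := by gcongr; linarith
      calc 1 - (1 + ε) / ((n : ℝ) + 1) ≤ 1 - (1 + ε) / ((n : ℝ) + 1 + 1) := by linarith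
        _ = _ := by ring
    rw [hypTerm_succ, norm_mul]
    push_cast
    calc _ ≤ ‖hypTerm (x₁ a) (x₂ a) (y₁ a) (y₂ a) n‖ *
          (((n : ℝ) + 1) ^ (1 + ε) / ((n : ℝ) + 1 + 1) ^ (1 + ε)) *
            ((n : ℝ) + 1 + 1) ^ (1 + ε) := by
          gcongr
          exact hratio.trans hbern
      _ = _ := by
          have : ((n : ℝ) + 1 + 1) ^ (1 + ε) ≠ 0 := by positivity
          field_simp

theorem summable_const_div_add_one_rpow (C : ℝ) {ε : ℝ} (hε : 0 < ε) :
    Summable fun n : ℕ => C / ((n : ℝ) + 1) ^ (1 + ε) := by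
  have h := (summable_nat_add_iff 1).2 (Real.summable_one_div_nat_rpow.2
    (show 1 < 1 + ε by linarith))
  simpa [div_eq_mul_inv] using h.mul_left C

theorem exists_norm_hypTerm_le_of_re {x₁ x₂ y₁ y₂ : ℂ} (h₁ : ∀ m : ℕ, y₁ + m ≠ 0)
    (h₂ : ∀ m : ℕ, y₂ + m ≠ 0) {ε : ℝ} (hε : 0 < ε)
    (hs : 1 + 2 * ε ≤ (y₁ + y₂ - x₁ - x₂).re) :
    ∃ C : ℝ, ∀ n : ℕ, ‖hypTerm x₁ x₂ y₁ y₂ n‖ ≤ C / ((n : ℝ) + 1) ^ (1 + ε) := by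
  obtain ⟨C, hC⟩ := exists_norm_hypTerm_le (isCompact_singleton (x := (0 : ℂ)))
    (x₁ := fun _ => x₁) (x₂ := fun _ => x₂) (y₁ := fun _ => y₁) (y₂ := fun _ => y₂)
    continuousOn_const continuousOn_const continuousOn_const continuousOn_const
    (fun _ _ => h₁) (fun _ _ => h₂) hε (fun _ _ => hs)
  exact ⟨C, fun n => hC 0 rfl n⟩

theorem summable_hypTerm {x₁ x₂ y₁ y₂ : ℂ} (h₁ : ∀ m : ℕ, y₁ + m ≠ 0)
    (h₂ : ∀ m : ℕ, y₂ + m ≠ 0) (hs : 1 < (y₁ + y₂ - x₁ - x₂).re) :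
    Summable (hypTerm x₁ x₂ y₁ y₂) := by
  obtain ⟨C, hC⟩ := exists_norm_hypTerm_le_of_re (x₁ := x₁) (x₂ := x₂) h₁ h₂
    (ε := ((y₁ + y₂ - x₁ - x₂).re - 1) / 2) (by linarith) (by linarith)
  exact Summable.of_norm_bounded (summable_const_div_add_one_rpow C (by linarith)) hC

/-! ### Convergence and holomorphy of the companion series -/

theorem firstTerm_eq_hypTerm (a : ℂ) :
    firstTerm a = hypTerm (a + 1 / 2) (a + 1 / 2) (2 * a + 1) (2 * a + 1) := by
  ext n; simp [firstTerm, hypTerm, sq]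

theorem secondTerm_eq_hypTerm (a : ℂ) :
    secondTerm a = hypTerm (a + 1 / 2) (a + 1 / 2) (2 * a + 1) (3 / 2 - a) := by
  ext n; simp [secondTerm, hypTerm, sq]

theorem summable_firstTerm {a : ℂ} (ha : 0 < a.re) : Summable (firstTerm a) := by
  rw [firstTerm_eq_hypTerm]
  have h := add_natCast_ne_zero_of_re_pos (x := 2 * a + 1) (by simp; linarith)
  refine summable_hypTerm h h ?_
  simp; linarith

theorem secondTerm_denom_ne_zero {a : ℂ} (ha : a.re < 1 / 2) (m : ℕ) : 3 / 2 - a + m ≠ 0 :=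
  add_natCast_ne_zero_of_re_pos (by norm_num; linarith) m

theorem add_natCast_ne_zero_of_ne {a : ℂ} (h : ∀ m : ℕ, a ≠ -((m : ℂ) + 1)) (m : ℕ) :
    a + 1 + m ≠ 0 := fun h0 => h m (by linear_combination h0)

theorem summable_secondTerm {a : ℂ} (ha : a.re < 1 / 2)
    (h : ∀ m : ℕ, 2 * a ≠ -((m : ℂ) + 1)) : Summable (secondTerm a) := by
  rw [secondTerm_eq_hypTerm]
  refine summable_hypTerm (add_natCast_ne_zero_of_ne h) (secondTerm_denom_ne_zero ha) ?_
  norm_num; linarith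

theorem differentiableAt_tsum_of_local_bound {F : ℕ → ℂ → ℂ} {a : ℂ} {r : ℝ} (hr : 0 < r)
    (hF : ∀ n, ∀ w ∈ Metric.closedBall a r, DifferentiableAt ℂ (F n) w) {u : ℕ → ℝ}
    (hu : Summable u) (hb : ∀ w ∈ Metric.closedBall a r, ∀ n, ‖F n w‖ ≤ u n) :
    DifferentiableAt ℂ (fun w => ∑' n, F n w) a := by
  have := differentiableOn_tsum_of_summable_norm (F := F) (U := Metric.ball a r) hu
    (fun n w hw => (hF n w (Metric.ball_subset_closedBall hw)).differentiableWithinAt)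
    Metric.isOpen_ball (fun n w hw => hb w (Metric.ball_subset_closedBall hw) n)
  exact this.differentiableAt (Metric.ball_mem_nhds a hr)

/-- The condition says that the entire function 1/Γ does not vanish at the point, so it is open even
though it involves infinitely many m. -/
theorem eventually_add_natCast_ne_zero {x : ℂ} (hx : ∀ m : ℕ, x + m ≠ 0) :
    ∀ᶠ y : ℂ in 𝓝 x, ∀ m : ℕ, y + (m : ℂ) ≠ 0 := by
  have hiff : ∀ y : ℂ, (Gamma y)⁻¹ ≠ 0 ↔ ∀ m : ℕ, y + m ≠ 0 := by
    intro y
    rw [ne_eq, inv_eq_zero, Gamma_eq_zero_iff]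
    push Not
    exact forall_congr' fun m => by rw [ne_eq, ne_eq, eq_neg_iff_add_eq_zero]
  have h := differentiable_one_div_Gamma.continuous.continuousAt.eventually_ne ((hiff x).2 hx)
  filter_upwards [h] with y hy using (hiff y).1 hy

theorem exists_closedBall_add_natCast_ne_zero {g : ℂ → ℂ} (hg : Continuous g) {a : ℂ}
    (ha : ∀ m : ℕ, g a + m ≠ 0) :
    ∃ r : ℝ, 0 < r ∧ ∀ w ∈ Metric.closedBall a r, ∀ m : ℕ, g w + m ≠ 0 :=
  Metric.nhds_basis_closedBall.eventually_iff.1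
    (hg.continuousAt.eventually (eventually_add_natCast_ne_zero ha))

theorem differentiableAt_tsum_secondTerm {a : ℂ} (ha : a.re < 1 / 2)
    (h : ∀ m : ℕ, 2 * a ≠ -((m : ℂ) + 1)) :
    DifferentiableAt ℂ (fun w => ∑' n, secondTerm w n) a := by
  obtain ⟨r₁, hr₁, h₁⟩ := exists_closedBall_add_natCast_ne_zero (g := fun w => 2 * w + 1)
    (by fun_prop) (add_natCast_ne_zero_of_ne h)
  -- The radius uses half the distance from Re a to 1/2, so an excess margin of half that distance
  -- survives on the closed ball; hence ε is a quarter of the distance.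
  set r := min r₁ ((1 / 2 - a.re) / 2)
  have hr : 0 < r := lt_min hr₁ (by linarith)
  have hrr : r ≤ (1 / 2 - a.re) / 2 := min_le_right _ _
  have hre : ∀ w ∈ Metric.closedBall a r, w.re ≤ a.re + (1 / 2 - a.re) / 2 := by
    intro w hw
    rw [mem_closedBall_iff_norm] at hw
    have := (re_le_norm (w - a)).trans hw
    rw [sub_re] at this
    linarith
  have hd₁ : ∀ w ∈ Metric.closedBall a r, ∀ m : ℕ, 2 * w + 1 + m ≠ 0 := fun w hw =>
    h₁ w (Metric.closedBall_subset_closedBall (min_le_left _ _) hw)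
  have hd₂ : ∀ w ∈ Metric.closedBall a r, ∀ m : ℕ, 3 / 2 - w + m ≠ 0 := fun w hw =>
    secondTerm_denom_ne_zero (by linarith [hre w hw])
  obtain ⟨C, hC⟩ := exists_norm_hypTerm_le (isCompact_closedBall a r)
    (x₁ := fun w => w + 1 / 2) (x₂ := fun w => w + 1 / 2) (y₁ := fun w => 2 * w + 1)
    (y₂ := fun w => 3 / 2 - w) (by fun_prop) (by fun_prop) (by fun_prop) (by fun_prop)
    hd₁ hd₂ (ε := (1 / 2 - a.re) / 4) (by linarith) (fun w hw => by
      have := hre w hw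
      norm_num; linarith)
  refine differentiableAt_tsum_of_local_bound (F := fun n w => secondTerm w n) hr
    (fun n w hw => ?_) (summable_const_div_add_one_rpow C (ε := (1 / 2 - a.re) / 4) (by linarith))
    (fun w hw n => by rw [secondTerm_eq_hypTerm]; exact hC w hw n)
  have d := differentiable_rising n
  unfold secondTerm
  refine DifferentiableAt.div ?_ ?_ (mul_ne_zero (rising_ne_zero (hd₁ w hw) n)
    (rising_ne_zero (hd₂ w hw) n))
  · exact (d.comp (g := fun x => rising x n) (f := fun w => w + 1 / 2) (by fun_prop)
      |>.differentiableAt).pow 2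
  · exact (d.comp (g := fun x => rising x n) (f := fun w => 2 * w + 1) (by fun_prop)
      |>.differentiableAt).mul (d.comp (g := fun x => rising x n) (f := fun w => 3 / 2 - w)
        (by fun_prop) |>.differentiableAt)

/-! ### Geometric convergence and holomorphy of f -/

/-- The hypergeometric part of the extended Ramanujan series. -/
noncomputable def ramanujanWeight (a : ℂ) (n : ℕ) : ℂ :=
  1 / 2 ^ (6 * n) * (rising (a + 1 / 2) n ^ 3 / rising (a + 1) n ^ 3)

theorem ramanujanTerm_eq (a : ℂ) (n : ℕ) :
    ramanujanTerm a n = ramanujanWeight a n * (42 * ((n : ℂ) + a) + 5) := rfl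

theorem ramanujanWeight_succ (a : ℂ) (n : ℕ) :
    ramanujanWeight a (n + 1) =
      ramanujanWeight a n * (1 / 64 * ((a + 1 / 2 + n) / (a + 1 + n)) ^ 3) := by
  simp only [ramanujanWeight, rising_succ, ← div_pow]
  rw [mul_div_mul_comm, mul_pow, show 6 * (n + 1) = 6 * n + 6 by ring, pow_add]
  norm_num
  ring

theorem differentiableAt_ramanujanWeight {a : ℂ} (h : ∀ m : ℕ, a + 1 + m ≠ 0) (n : ℕ) :
    DifferentiableAt ℂ (fun w => ramanujanWeight w n) a := by
  have d := differentiable_rising n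
  unfold ramanujanWeight
  refine (DifferentiableAt.div (c := fun w : ℂ => rising (w + 1 / 2) n ^ 3)
    (d := fun w : ℂ => rising (w + 1) n ^ 3) ?_ ?_
    (pow_ne_zero 3 (rising_ne_zero h n))).const_mul _
  · exact (d.comp (g := fun x => rising x n) (f := fun w => w + 1 / 2) (by fun_prop)
      |>.differentiableAt).pow 3
  · exact (d.comp (g := fun x => rising x n) (f := fun w => w + 1) (by fun_prop)
      |>.differentiableAt).pow 3

/-- Once n ≥ 3R the quotient of linear factors has norm at most 2, so the weight shrinks by at least
2³/64 = 1/8 per step. The weaker rate 1/2 suffices and is uniform on the ball. -/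
theorem exists_norm_ramanujanTerm_le {a : ℂ} {r : ℝ}
    (h : ∀ w ∈ Metric.closedBall a r, ∀ m : ℕ, w + 1 + m ≠ 0) :
    ∃ C D : ℝ, ∀ w ∈ Metric.closedBall a r, ∀ n : ℕ,
      ‖ramanujanTerm w n‖ ≤ C * (1 / 2) ^ n * (42 * n + D) := by
  set R := ‖a‖ + r
  have hw : ∀ w ∈ Metric.closedBall a r, ‖w‖ ≤ R := by
    intro w hw
    rw [mem_closedBall_iff_norm] at hw
    calc ‖w‖ = ‖a + (w - a)‖ := by congr 1; ring
      _ ≤ _ := (norm_add_le _ _).trans (by simp only [R]; linarith)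
  have hb : ∀ n : ℕ, ∃ C : ℝ, ∀ w ∈ Metric.closedBall a r, ‖ramanujanWeight w n‖ * 2 ^ n ≤ C := by
    intro n
    obtain ⟨C, hC⟩ := (isCompact_closedBall a r).exists_bound_of_continuousOn
      (f := fun w => ramanujanWeight w n) fun w hw =>
        (differentiableAt_ramanujanWeight (h w hw) n).continuousAt.continuousWithinAt
    exact ⟨C * 2 ^ n, fun w hw => mul_le_mul_of_nonneg_right (hC w hw) (by positivity)⟩
  choose B hB using hb
  obtain ⟨N, hN⟩ := exists_nat_ge (3 * R)
  refine ⟨∑ i ∈ Finset.range (N + 1), |B i|, 42 * R + 5, fun w hwr n => ?_⟩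
  have hle : ∀ i ≤ N, ‖ramanujanWeight w i‖ * 2 ^ i ≤ ∑ i ∈ Finset.range (N + 1), |B i| :=
    fun i hi => ((hB i w hwr).trans (le_abs_self _)).trans <|
      Finset.single_le_sum (f := fun i => |B i|) (fun _ _ => abs_nonneg _)
        (Finset.mem_range.2 (by omega))
  have hweight : ∀ n, N ≤ n →
      ‖ramanujanWeight w n‖ * 2 ^ n ≤ ∑ i ∈ Finset.range (N + 1), |B i| := by
    intro n hn
    induction n, hn using Nat.le_induction with
    | base => exact hle N le_rfl
    | succ n hn ih =>
      refine le_trans ?_ ih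
      have hn' : 3 * R ≤ n := hN.trans (by exact_mod_cast hn)
      have hn0 : (0 : ℝ) ≤ n := Nat.cast_nonneg n
      have hwR := hw w hwr
      have hratio : ‖(w + 1 / 2 + n) / (w + 1 + n)‖ ≤ 2 := by
        rw [norm_div, div_le_iff₀ (norm_pos_iff.2 (h w hwr n))]
        have h1 : ‖w + 1 / 2 + n‖ ≤ R + 1 / 2 + n := by
          refine (norm_add_le _ _).trans ?_
          rw [norm_natCast]
          gcongr
          refine (norm_add_le _ _).trans ?_
          norm_num; exact hwR
        have h2 : (n : ℝ) + 1 - R ≤ ‖w + 1 + n‖ := by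
          have := norm_sub_norm_le ((n + 1 : ℕ) : ℂ) (-w)
          rw [norm_natCast, norm_neg, sub_neg_eq_add] at this
          push_cast at this
          rw [show w + 1 + (n : ℂ) = n + 1 + w by ring]
          linarith
        linarith
      rw [ramanujanWeight_succ, norm_mul, norm_mul, norm_pow]
      have h64 : ‖(1 / 64 : ℂ)‖ = 1 / 64 := by norm_num
      rw [h64]
      calc _ ≤ ‖ramanujanWeight w n‖ * (1 / 64 * 2 ^ 3) * 2 ^ (n + 1) := by gcongr
        _ = ‖ramanujanWeight w n‖ * 2 ^ n * (1 / 4) := by ring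
        _ ≤ _ := mul_le_of_le_one_right (by positivity) (by norm_num)
  have hv : ‖ramanujanWeight w n‖ * 2 ^ n ≤ ∑ i ∈ Finset.range (N + 1), |B i| :=
    (le_total n N).elim (hle n) (hweight n)
  have hv' : ‖ramanujanWeight w n‖ ≤ (∑ i ∈ Finset.range (N + 1), |B i|) * (1 / 2) ^ n := by
    rw [one_div, inv_pow, ← div_eq_mul_inv, le_div_iff₀ (by positivity)]
    exact hv
  rw [ramanujanTerm_eq, norm_mul]
  refine mul_le_mul hv' ?_ (norm_nonneg _) (by positivity)
  refine (norm_add_le _ _).trans ?_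
  rw [norm_mul]
  have := norm_add_le (n : ℂ) w
  rw [norm_natCast] at this
  have hwR := hw w hwr
  norm_num
  linarith

theorem summable_geometric_mul_linear (C D : ℝ) :
    Summable fun n : ℕ => C * (1 / 2 : ℝ) ^ n * (42 * n + D) := by
  have h1 := summable_pow_mul_geometric_of_norm_lt_one 1 (r := (1 / 2 : ℝ)) (by norm_num)
  have h0 := summable_geometric_of_lt_one (r := (1 / 2 : ℝ)) (by norm_num) (by norm_num)
  refine ((h1.mul_left (C * 42)).add (h0.mul_left (C * D))).congr fun n => ?_
  ring

theorem summable_ramanujanTerm {a : ℂ} (h : ∀ m : ℕ, a ≠ -((m : ℂ) + 1)) :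
    Summable (ramanujanTerm a) := by
  obtain ⟨C, D, hCD⟩ := exists_norm_ramanujanTerm_le (a := a) (r := 0) fun w hw m => by
    have : w = a := by simpa using hw
    rw [this]; exact add_natCast_ne_zero_of_ne h m
  exact Summable.of_norm_bounded (summable_geometric_mul_linear C D) fun n => hCD a (by simp) n

theorem differentiableAt_ramanujanF {a : ℂ} (h : ∀ m : ℕ, a ≠ -((m : ℂ) + 1)) :
    DifferentiableAt ℂ ramanujanF a := by
  obtain ⟨r, hr, hd⟩ := exists_closedBall_add_natCast_ne_zero (g := fun w => w + 1)
    (by fun_prop) (add_natCast_ne_zero_of_ne h)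
  obtain ⟨C, D, hCD⟩ := exists_norm_ramanujanTerm_le hd
  refine differentiableAt_tsum_of_local_bound (F := fun n w => ramanujanTerm w n) hr
    (fun n w hw => ?_) (summable_geometric_mul_linear C D) hCD
  exact (differentiableAt_ramanujanWeight (hd w hw) n).mul (by fun_prop)

/-! ### The Wilf–Zeilberger pair -/

/-- The quotient `(x + 1/2)_k / (2x + 1)_k`. -/
noncomputable def halfRatio (x : ℂ) (k : ℕ) : ℂ := rising (x + 1 / 2) k / rising (2 * x + 1) k

/-- The first component of the Wilf–Zeilberger pair. -/
noncomputable def wzF (a : ℂ) (n k : ℕ) : ℂ :=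
  32 * (a + n) * (ramanujanWeight a n * halfRatio (a + n) k ^ 2)

/-- The numerator of the Wilf–Zeilberger certificate. -/
noncomputable def wzNumerator (h k : ℂ) : ℂ :=
  16 * k ^ 3 + (52 * h - 16) * k ^ 2 + (56 * h ^ 2 - 32 * h) * k + (21 * h - 16) * h ^ 2

/-- The second component of the Wilf–Zeilberger pair. -/
noncomputable def wzG (a : ℂ) (n k : ℕ) : ℂ :=
  ramanujanWeight a n * halfRatio (a + n) k ^ 2 *
    (wzNumerator (2 * (a + n) + 1) k / (2 * (a + n) + 1 + k) ^ 2)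

theorem halfRatio_succ (x : ℂ) (k : ℕ) :
    halfRatio x (k + 1) = halfRatio x k * ((x + 1 / 2 + k) / (2 * x + 1 + k)) := by
  simp only [halfRatio, rising_succ]
  rw [mul_div_mul_comm]

theorem halfRatio_shift {x : ℂ} (hx : 0 < x.re) (k : ℕ) :
    halfRatio (x + 1) k = halfRatio x k *
      (4 * (x + 1) * (x + 1 / 2 + k) / ((2 * x + 1 + k) * (2 * x + 1 + 1 + k))) := by
  have h1 : 0 < (x + 1 / 2).re := by norm_num; linarith
  have h2 : 0 < (2 * x + 1).re := by norm_num; linarith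
  have h3 : 0 < (2 * x + 1 + 1).re := by norm_num; linarith
  have n1 := add_natCast_ne_zero_of_re_pos h1
  have n2 := add_natCast_ne_zero_of_re_pos h2
  have n3 := add_natCast_ne_zero_of_re_pos h3
  have e1 := rising_shift (x + 1 / 2) k
  have e2 := rising_shift (2 * x + 1) k
  have e3 := rising_shift (2 * x + 1 + 1) k
  simp only [halfRatio]
  rw [show x + 1 + 1 / 2 = x + 1 / 2 + 1 by ring, show 2 * (x + 1) + 1 = 2 * x + 1 + 1 + 1 by ring]
  have r1 : rising (x + 1 / 2 + 1) k = rising (x + 1 / 2) k * (x + 1 / 2 + k) / (x + 1 / 2) := by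
    rw [← e1, mul_div_cancel_right₀]; simpa using n1 0
  have h20 : 2 * x + 1 ≠ 0 := by simpa using n2 0
  have h30 : 2 * x + 1 + 1 ≠ 0 := by simpa using n3 0
  have h10 : x + 1 / 2 ≠ 0 := by simpa using n1 0
  have r2 : rising (2 * x + 1 + 1 + 1) k =
      rising (2 * x + 1) k * (2 * x + 1 + k) * (2 * x + 1 + 1 + k) /
        ((2 * x + 1) * (2 * x + 1 + 1)) := by
    rw [eq_div_iff (mul_ne_zero h20 h30)]
    linear_combination (2 * x + 1) * e3 + (2 * x + 1 + 1 + k) * e2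
  rw [r1, r2]
  have hr := rising_ne_zero_of_re_pos h2 k
  have hk2 := n2 k
  have hk3 := n3 k
  have h1' : x + 1 / 2 = (2 * x + 1) / 2 := by ring
  have h3' : 4 * (x + 1) = 2 * (2 * x + 1 + 1) := by ring
  rw [h3']
  generalize hu : 2 * x + 1 + 1 + (k : ℂ) = u at *
  generalize hv : 2 * x + 1 + (k : ℂ) = v at *
  generalize hq : 2 * x + 1 + 1 = q at *
  generalize rising (2 * x + 1) k = ρ at *
  generalize rising (x + 1 / 2) k = σ at *
  rw [h1']
  generalize 2 * x + 1 = p at *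
  field_simp

theorem add_natCast_re_pos {a : ℂ} (ha : 0 < a.re) (n : ℕ) : 0 < (a + n).re := by
  have : (0 : ℝ) ≤ n := Nat.cast_nonneg n
  simp; linarith

/-- The pair relation reduced to one rational identity. With x = a + n it uses h = 2x + 1 and d = h
+ k, so that x + 1/2 = h/2, x + 1/2 + k = d − h/2, and the denominators of the shifted factors are d
and d + 1. Here w stands for the weight and ρ for the half ratio. -/
theorem wz_identity (w ρ : ℂ) {h d : ℂ} (hd : d ≠ 0) (hd1 : d + 1 ≠ 0) (hh : h + 1 ≠ 0) :
    32 * ((h + 1) / 2) * (w * (1 / 64 * (h / 2 / ((h + 1) / 2)) ^ 3) *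
      (ρ * (4 * ((h + 1) / 2) * (d - h / 2) / (d * (d + 1)))) ^ 2) -
        32 * ((h - 1) / 2) * (w * ρ ^ 2) =
      w * (ρ * ((d - h / 2) / d)) ^ 2 * (wzNumerator h (d - h + 1) / (d + 1) ^ 2) -
        w * ρ ^ 2 * (wzNumerator h (d - h) / d ^ 2) := by
  unfold wzNumerator
  field_simp
  ring

theorem wz_pair {a : ℂ} (ha : 0 < a.re) (n k : ℕ) :
    wzF a (n + 1) k - wzF a n k = wzG a n (k + 1) - wzG a n k := by
  have hx := add_natCast_re_pos ha n
  have h2 : 0 < (2 * (a + n) + 1).re := by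
    rw [add_re, mul_re]; norm_num at hx ⊢; linarith
  have n2 := add_natCast_ne_zero_of_re_pos h2
  have hk := n2 k
  have hk1 := n2 (k + 1)
  have hx1 : a + n + 1 ≠ 0 := by
    simpa using add_natCast_ne_zero_of_re_pos hx 1
  simp only [wzF, wzG]
  rw [show a + ((n + 1 : ℕ) : ℂ) = a + n + 1 by push_cast; ring, halfRatio_shift hx, halfRatio_succ,
    ramanujanWeight_succ, show a + 1 / 2 + (n : ℂ) = a + n + 1 / 2 by ring,
    show a + 1 + (n : ℂ) = a + n + 1 by ring]
  have hd1 : 2 * (a + n) + 1 + k + 1 ≠ 0 := by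
    intro h; apply hk1; push_cast; rw [← h]; ring
  have hh : 2 * (a + n) + 1 + 1 ≠ 0 := by
    intro h; apply hx1; linear_combination h / 2
  have key := wz_identity (ramanujanWeight a n) (halfRatio (a + n) k) hk hd1 hh
  push_cast
  unfold wzNumerator at key ⊢
  linear_combination key

theorem wzG_zero {a : ℂ} (ha : 0 < a.re) (n : ℕ) : wzG a n 0 = ramanujanTerm a n := by
  have hx := add_natCast_re_pos ha n
  have h2 : 0 < (2 * (a + n) + 1).re := by
    rw [add_re, mul_re]; norm_num at hx ⊢; linarith
  have h20 : 2 * (a + n) + 1 ≠ 0 := by simpa using add_natCast_ne_zero_of_re_pos h2 0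
  simp only [wzG, wzNumerator, halfRatio, rising_zero, ramanujanTerm_eq, Nat.cast_zero, add_zero]
  rw [show (42 * ((n : ℂ) + a) + 5) = 21 * (2 * (a + n) + 1) - 16 by ring]
  generalize 2 * (a + (n : ℂ)) + 1 = h at *
  field_simp
  ring

theorem wzF_zero (a : ℂ) (k : ℕ) : wzF a 0 k = 32 * a * firstTerm a k := by
  simp [wzF, halfRatio, ramanujanWeight, rising_zero, firstTerm, div_pow]

/-! ### Decay of the pair and the first identity -/

/-- Duplication splits (2a+1)_{2n} into 4^n (a+1/2)_n (a+1)_n. Squaring the Beta quotient then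
leaves one factor (a+1/2)_n/(a+1)_n and 64^(-n)·16^n = 4^(-n). -/
theorem weight_mul_halfRatio_sq {a : ℂ} (ha : 0 < a.re) (n k : ℕ) :
    ramanujanWeight a n * halfRatio (a + n) k ^ 2 =
      1 / 4 ^ n * (rising (a + 1 / 2) n / rising (a + 1) n) *
        (betaIntegral (a + 1 / 2 + n) (a + 1 / 2 + (n + k : ℕ)) /
          betaIntegral (a + 1 / 2) (a + 1 / 2)) ^ 2 := by
  have hm : 0 < (a + 1 / 2).re := by norm_num; linarith
  have h1 : 0 < (a + 1).re := by norm_num; linarith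
  have hx := add_natCast_re_pos ha n
  have h2 : 0 < (2 * (a + n) + 1).re := by
    rw [add_re, mul_re]; norm_num at hx ⊢; linarith
  rw [betaIntegral_add_natCast hm hm, mul_div_cancel_left₀ _ (betaIntegral_ne_zero hm hm),
    show a + 1 / 2 + (a + 1 / 2) = 2 * (a + 1 / 2) by ring, show n + (n + k) = 2 * n + k by ring,
    rising_add (2 * (a + 1 / 2)), rising_two_mul, rising_add (a + 1 / 2) n k, halfRatio,
    ramanujanWeight, show a + 1 / 2 + 1 / 2 = a + 1 by ring,
    show 2 * (a + 1 / 2) + ((2 * n : ℕ) : ℂ) = 2 * (a + n) + 1 by push_cast; ring,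
    show a + n + 1 / 2 = a + 1 / 2 + n by ring]
  have e1 := rising_ne_zero_of_re_pos hm n
  have e2 := rising_ne_zero_of_re_pos h1 n
  have e3 := rising_ne_zero_of_re_pos h2 k
  have e64 : (2 : ℂ) ^ (6 * n) = 4 ^ n * 4 ^ n * 4 ^ n := by
    rw [← mul_pow, ← mul_pow, pow_mul]; norm_num
  rw [e64]
  field_simp

theorem norm_rising_half_le {a : ℂ} (ha : 0 < a.re) (n : ℕ) :
    ‖rising (a + 1 / 2) n / rising (a + 1) n‖ ≤ 1 := by
  have h1 : 0 < (a + 1).re := by norm_num; linarith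
  induction n with
  | zero => simp [rising_zero]
  | succ n ih =>
    rw [rising_succ, rising_succ, mul_div_mul_comm, norm_mul]
    refine mul_le_one₀ ih (norm_nonneg _) ?_
    rw [norm_div, div_le_one (norm_pos_iff.2 (add_natCast_ne_zero_of_re_pos h1 n)), norm_def,
      norm_def]
    apply Real.sqrt_le_sqrt
    simp only [normSq_apply, add_re, add_im, natCast_re, natCast_im, one_re, one_im]
    have h : ((1 : ℂ) / 2).re = 1 / 2 := by norm_num
    have h' : ((1 : ℂ) / 2).im = 0 := by norm_num
    rw [h, h']
    have : (0 : ℝ) ≤ n := Nat.cast_nonneg n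
    nlinarith

theorem exists_norm_weight_mul_halfRatio_sq_le {a : ℂ} (ha : 0 < a.re) :
    ∃ C : ℝ, 0 ≤ C ∧ ∀ n k : ℕ, ‖ramanujanWeight a n * halfRatio (a + n) k ^ 2‖ ≤
      (1 / 4) ^ n * (C / ((k : ℝ) + 1) ^ (1 + a.re)) := by
  set s : ℝ := a.re + 1 / 2
  have hs : 0 < s := by simp only [s]; linarith
  have hs' : 0 < (s : ℂ).re := by simpa
  have hm : 0 < (a + 1 / 2).re := by norm_num; linarith
  have h2s : 0 < (((s : ℂ) + s)).re := by simp; linarith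
  obtain ⟨C, hC⟩ := exists_norm_hypTerm_le_of_re (x₁ := s) (x₂ := s)
    (add_natCast_ne_zero_of_re_pos h2s) (add_natCast_ne_zero_of_re_pos h2s) ha
    (by simp [s]; linarith)
  have hC0 : 0 ≤ C := by
    have := (norm_nonneg _).trans (hC 0)
    simpa using this
  set D := ‖betaIntegral s s / betaIntegral (a + 1 / 2) (a + 1 / 2)‖
  refine ⟨D ^ 2 * C, by positivity, fun n k => ?_⟩
  rw [weight_mul_halfRatio_sq ha, norm_mul, norm_mul, norm_pow]
  have hb : ‖betaIntegral (a + 1 / 2 + n) (a + 1 / 2 + (n + k : ℕ)) /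
      betaIntegral (a + 1 / 2) (a + 1 / 2)‖ ≤ D * ‖rising s k / rising (s + s) k‖ := by
    have hn : (0 : ℝ) ≤ n := Nat.cast_nonneg n
    have hk : (0 : ℝ) ≤ k := Nat.cast_nonneg k
    -- The shift n is discarded in both arguments and k is kept in one. What remains is a real Beta
    -- quotient in k, whose square is a term with excess 2s = 1 + 2 Re a.
    have h := norm_betaIntegral_le (u := a + 1 / 2 + n) (v := a + 1 / 2 + (n + k : ℕ))
      (u₀ := s) (v₀ := s + k) hs (by linarith) (by norm_num [s])
      (by norm_num [s])
    have e := betaIntegral_add_natCast hs' hs' 0 k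
    simp only [Nat.cast_zero, add_zero, rising_zero, one_mul, zero_add] at e
    push_cast at h
    rw [e] at h
    rw [← norm_mul, div_mul_eq_mul_div, norm_div, norm_div]
    push_cast
    gcongr
  have h4 : ‖(1 / 4 ^ n : ℂ)‖ = (1 / 4) ^ n := by simp
  have hr := norm_rising_half_le ha n
  calc _ ≤ (1 / 4 : ℝ) ^ n * 1 * (D * ‖rising s k / rising (s + s) k‖) ^ 2 := by
        rw [h4]; gcongr
    _ = (1 / 4) ^ n * (D ^ 2 * ‖hypTerm s s (s + s) (s + s) k‖) := by
        rw [hypTerm, ← sq, ← sq, ← div_pow, norm_pow]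
        ring
    _ ≤ (1 / 4) ^ n * (D ^ 2 * (C / ((k : ℝ) + 1) ^ (1 + a.re))) := by
        gcongr; exact hC k
    _ = _ := by ring

theorem norm_wzNumerator_le {h k : ℂ} {H y : ℝ} (hh : ‖h‖ ≤ H) (hk : ‖k‖ ≤ y) (hH : 1 ≤ H)
    (hy : 1 ≤ y) : ‖wzNumerator h k‖ ≤ 209 * H ^ 3 * y ^ 3 := by
  have hH0 : 0 ≤ H := by linarith
  have b1 : ‖16 * k ^ 3‖ ≤ 16 * H ^ 3 * y ^ 3 := by
    rw [norm_mul, norm_pow, show ‖(16 : ℂ)‖ = 16 by norm_num]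
    calc 16 * ‖k‖ ^ 3 ≤ 16 * 1 * y ^ 3 := by rw [mul_one]; gcongr
      _ ≤ _ := by gcongr; exact one_le_pow₀ hH
  have b2 : ‖(52 * h - 16) * k ^ 2‖ ≤ 68 * H ^ 3 * y ^ 3 := by
    have : ‖52 * h - 16‖ ≤ 68 * H := by
      refine (norm_sub_le _ _).trans ?_
      rw [norm_mul]; norm_num; linarith
    rw [norm_mul, norm_pow]
    calc _ ≤ 68 * H * y ^ 2 := by gcongr
      _ ≤ 68 * H ^ 3 * y ^ 3 := by
        exact mul_le_mul (mul_le_mul_of_nonneg_left (le_self_pow₀ hH (by norm_num)) (by norm_num))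
          (pow_le_pow_right₀ hy (by norm_num)) (by positivity) (by positivity)
  have b3 : ‖(56 * h ^ 2 - 32 * h) * k‖ ≤ 88 * H ^ 3 * y ^ 3 := by
    have : ‖56 * h ^ 2 - 32 * h‖ ≤ 88 * H ^ 2 := by
      refine (norm_sub_le _ _).trans ?_
      rw [norm_mul, norm_mul, norm_pow]; norm_num
      nlinarith [norm_nonneg h]
    rw [norm_mul]
    calc _ ≤ 88 * H ^ 2 * y := by gcongr
      _ ≤ 88 * H ^ 3 * y ^ 3 := by
        exact mul_le_mul (mul_le_mul_of_nonneg_left (pow_le_pow_right₀ hH (by norm_num))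
          (by norm_num)) (le_self_pow₀ hy (by norm_num)) (by positivity) (by positivity)
  have b4 : ‖(21 * h - 16) * h ^ 2‖ ≤ 37 * H ^ 3 * y ^ 3 := by
    have : ‖21 * h - 16‖ ≤ 37 * H := by
      refine (norm_sub_le _ _).trans ?_
      rw [norm_mul]; norm_num; linarith
    rw [norm_mul, norm_pow]
    calc _ ≤ 37 * H * H ^ 2 := by gcongr
      _ = 37 * H ^ 3 * 1 := by ring
      _ ≤ _ := by gcongr; exact one_le_pow₀ hy
  unfold wzNumerator
  refine (norm_add_le _ _).trans ?_
  have := norm_add_le (16 * k ^ 3 + (52 * h - 16) * k ^ 2) ((56 * h ^ 2 - 32 * h) * k)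
  have := norm_add_le (16 * k ^ 3) ((52 * h - 16) * k ^ 2)
  linarith

/-- The certificate is cubic in k over a quadratic, so it costs one power of k + 1. Decay of order
(k+1)^(-Re a) remains, which is where Re a > 0 is needed. -/
theorem exists_norm_wzG_le {a : ℂ} (ha : 0 < a.re) :
    ∃ C D : ℝ, 0 ≤ C ∧ 0 ≤ D ∧ ∀ n k : ℕ,
      ‖wzG a n k‖ ≤ (1 / 4) ^ n * (2 * n + D) ^ 3 * (C / ((k : ℝ) + 1) ^ a.re) := by
  obtain ⟨C, hC0, hC⟩ := exists_norm_weight_mul_halfRatio_sq_le ha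
  refine ⟨209 * C, ‖2 * a + 1‖ + 1, by positivity, by positivity, fun n k => ?_⟩
  have hk0 : (0 : ℝ) ≤ k := Nat.cast_nonneg k
  have hn0 : (0 : ℝ) ≤ n := Nat.cast_nonneg n
  set H : ℝ := 2 * n + (‖2 * a + 1‖ + 1)
  have hH : 1 ≤ H := by simp only [H]; linarith [norm_nonneg (2 * a + 1)]
  have hh : ‖2 * (a + n) + 1‖ ≤ H := by
    have : 2 * (a + n) + 1 = (2 * a + 1) + 2 * n := by ring
    rw [this]
    refine (norm_add_le _ _).trans ?_
    rw [norm_mul, norm_natCast]; norm_num [H]; linarith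
  have hnum := norm_wzNumerator_le hh (k := k) (y := k + 1) (by rw [norm_natCast]; linarith) hH
    (by linarith)
  have hden : (k : ℝ) + 1 ≤ ‖2 * (a + n) + 1 + k‖ := by
    refine le_trans ?_ (re_le_norm _)
    simp; linarith
  have hpow : ((k : ℝ) + 1) ^ (1 + a.re) = (k + 1) * ((k : ℝ) + 1) ^ a.re := by
    rw [Real.rpow_add (by positivity), Real.rpow_one]
  rw [wzG, norm_mul, norm_div, norm_pow]
  calc _ ≤ (1 / 4) ^ n * (C / ((k : ℝ) + 1) ^ (1 + a.re)) *
        (209 * H ^ 3 * ((k : ℝ) + 1) ^ 3 / ((k : ℝ) + 1) ^ 2) := by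
        gcongr
        exact hC n k
    _ = _ := by
        rw [hpow]
        have : ((k : ℝ) + 1) ^ a.re ≠ 0 := by positivity
        field_simp

theorem summable_quarter_pow_mul_cube (D : ℝ) :
    Summable fun n : ℕ => (1 / 4 : ℝ) ^ n * (2 * n + D) ^ 3 := by
  have h (j : ℕ) := summable_pow_mul_geometric_of_norm_lt_one j (r := (1 / 4 : ℝ)) (by norm_num)
  refine ((((h 3).mul_left 8).add ((h 2).mul_left (12 * D))).add
    (((h 1).mul_left (6 * D ^ 2)).add ((h 0).mul_left (D ^ 3)))).congr fun n => ?_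
  ring

theorem tendsto_wzF {a : ℂ} (ha : 0 < a.re) (k : ℕ) :
    Tendsto (fun n => wzF a n k) atTop (𝓝 0) := by
  obtain ⟨C, hC0, hC⟩ := exists_norm_weight_mul_halfRatio_sq_le ha
  -- Any constant making the cubed base at least 1 and at least ‖a + n‖ would do; the cube only lets
  -- an existing summability lemma be reused.
  have h := (summable_quarter_pow_mul_cube (32 * ‖a‖ + 32)).tendsto_atTop_zero.mul_const
    (32 * (C / ((k : ℝ) + 1) ^ (1 + a.re)))
  rw [zero_mul] at h
  refine squeeze_zero_norm (fun n => ?_) h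
  have hn0 : (0 : ℝ) ≤ n := Nat.cast_nonneg n
  rw [wzF, norm_mul, norm_mul]
  have h1 : ‖a + n‖ ≤ (2 * n + (32 * ‖a‖ + 32)) ^ 3 := by
    refine (norm_add_le _ _).trans ?_
    rw [norm_natCast]
    refine le_trans ?_ (le_self_pow₀ ?_ (by norm_num)) <;> linarith [norm_nonneg a]
  rw [show ‖(32 : ℂ)‖ = 32 by norm_num]
  calc _ ≤ 32 * (2 * n + (32 * ‖a‖ + 32)) ^ 3 *
        ((1 / 4) ^ n * (C / ((k : ℝ) + 1) ^ (1 + a.re))) := by gcongr; exact hC n k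
    _ = _ := by ring

theorem ramanujanF_eq_tsum_firstTerm {a : ℂ} (ha : 0 < a.re) :
    ramanujanF a = 32 * a * ∑' n, firstTerm a n := by
  obtain ⟨C, D, hC0, hD0, hG⟩ := exists_norm_wzG_le ha
  have hsum := summable_quarter_pow_mul_cube D
  have hGs (k : ℕ) : Summable fun n => wzG a n k :=
    Summable.of_norm_bounded (hsum.mul_right _) fun n => hG n k
  -- The rectangle sum of the pair relation, telescoped in n on one side and in k on the other. The
  -- limit N → ∞ is taken first, for fixed K, and K → ∞ afterwards.
  have htel (N K : ℕ) : ∑ k ∈ Finset.range K, (wzF a N k - wzF a 0 k) =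
      ∑ n ∈ Finset.range N, wzG a n K - ∑ n ∈ Finset.range N, wzG a n 0 := by
    rw [← Finset.sum_sub_distrib]
    calc _ = ∑ k ∈ Finset.range K, ∑ n ∈ Finset.range N, (wzF a (n + 1) k - wzF a n k) :=
          Finset.sum_congr rfl fun k _ => (Finset.sum_range_sub (fun n => wzF a n k) N).symm
      _ = ∑ n ∈ Finset.range N, ∑ k ∈ Finset.range K, (wzG a n (k + 1) - wzG a n k) := by
          rw [Finset.sum_comm]
          exact Finset.sum_congr rfl fun n _ => Finset.sum_congr rfl fun k _ => wz_pair ha n k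
      _ = _ := Finset.sum_congr rfl fun n _ => Finset.sum_range_sub (fun k => wzG a n k) K
  have hlim (K : ℕ) : ∑ k ∈ Finset.range K, (0 - wzF a 0 k) =
      ∑' n, wzG a n K - ∑' n, wzG a n 0 := by
    refine tendsto_nhds_unique (tendsto_finsetSum (Finset.range K) fun k _ =>
      (tendsto_wzF ha k).sub_const (wzF a 0 k)) ?_
    simp_rw [htel]
    exact (hGs K).hasSum.tendsto_sum_nat.sub (hGs 0).hasSum.tendsto_sum_nat
  have hG0 : Tendsto (fun K => ∑' n, wzG a n K) atTop (𝓝 0) := by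
    have h1 : Tendsto (fun K : ℕ => (C / ((K : ℝ) + 1) ^ a.re)) atTop (𝓝 0) := by
      refine Tendsto.div_atTop tendsto_const_nhds ((tendsto_rpow_atTop ha).comp ?_)
      exact tendsto_atTop_add_const_right _ _ tendsto_natCast_atTop_atTop
    have h2 := h1.const_mul (∑' n : ℕ, (1 / 4 : ℝ) ^ n * (2 * n + D) ^ 3)
    rw [mul_zero] at h2
    refine squeeze_zero_norm (fun K => ?_) h2
    rw [← tsum_mul_right]
    exact tsum_of_norm_bounded (hsum.mul_right _).hasSum fun n => hG n K
  have hF : Tendsto (fun K => ∑ k ∈ Finset.range K, (0 - wzF a 0 k)) atTop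
      (𝓝 (-(32 * a * ∑' n, firstTerm a n))) := by
    have := (((summable_firstTerm ha).hasSum.mul_left (32 * a)).tendsto_sum_nat).neg
    refine this.congr fun K => ?_
    rw [← Finset.sum_neg_distrib]
    exact Finset.sum_congr rfl fun k _ => by rw [wzF_zero, zero_sub]
  simp_rw [hlim] at hF
  have := tendsto_nhds_unique hF (hG0.sub_const _)
  rw [zero_sub, neg_inj] at this
  rw [this]
  exact tsum_congr fun n => (wzG_zero ha n).symm

/-! ### Power series of the incomplete Beta integral -/

/-- The integrand of the Beta integral. -/
noncomputable def betaIntegrand (u v : ℂ) (x : ℝ) : ℂ :=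
  (x : ℂ) ^ (u - 1) * (1 - (x : ℂ)) ^ (v - 1)

/-- The incomplete Beta integral. -/
noncomputable def incompleteBeta (u v : ℂ) (t : ℝ) : ℂ := ∫ x : ℝ in 0..t, betaIntegrand u v x

theorem intervalIntegrable_betaIntegrand {u v : ℂ} (hu : 0 < u.re) (hv : 0 < v.re) {s t : ℝ}
    (hs : s ∈ Set.Icc (0 : ℝ) 1) (ht : t ∈ Set.Icc (0 : ℝ) 1) :
    IntervalIntegrable (betaIntegrand u v) MeasureTheory.volume s t := by
  refine (betaIntegral_convergent hu hv).mono_set ?_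
  rw [Set.uIcc_of_le (zero_le_one' ℝ)]
  exact Set.uIcc_subset_Icc hs ht

theorem incompleteBeta_add {u v : ℂ} (hu : 0 < u.re) (hv : 0 < v.re) {t : ℝ}
    (ht : t ∈ Set.Icc (0 : ℝ) 1) :
    incompleteBeta u v t + incompleteBeta v u (1 - t) = betaIntegral u v := by
  have h0 : (0 : ℝ) ∈ Set.Icc (0 : ℝ) 1 := by simp
  have h1 : (1 : ℝ) ∈ Set.Icc (0 : ℝ) 1 := by simp
  have e : incompleteBeta v u (1 - t) = ∫ x : ℝ in t..1, betaIntegrand u v x := by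
    have := intervalIntegral.integral_comp_sub_left (a := t) (b := 1) (betaIntegrand v u) 1
    rw [sub_self] at this
    rw [incompleteBeta, ← this]
    refine intervalIntegral.integral_congr fun x _ => ?_
    simp only [betaIntegrand]
    push_cast
    rw [sub_sub_cancel, mul_comm]
  rw [e, incompleteBeta, intervalIntegral.integral_add_adjacent_intervals
    (intervalIntegrable_betaIntegrand hu hv h0 ht) (intervalIntegrable_betaIntegrand hu hv ht h1)]
  rfl

/-- Integrate the derivative of x^u (1-x)^v over (0,t). As Re u may be below 1, differentiability
can fail at 0; continuity there, from Re u > 0, is enough. -/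
theorem incompleteBeta_recurrence {u v : ℂ} (hu : 0 < u.re) (hv : 0 < v.re) {t : ℝ}
    (ht : t ∈ Set.Ioo (0 : ℝ) 1) :
    u * incompleteBeta u v t =
      (t : ℂ) ^ u * (1 - (t : ℂ)) ^ v + (u + v) * incompleteBeta (u + 1) v t := by
  have hu1 : 0 < (u + 1).re := by simp; linarith
  have h0 : (0 : ℝ) ∈ Set.Icc (0 : ℝ) 1 := by simp
  have ht' : t ∈ Set.Icc (0 : ℝ) 1 := ⟨ht.1.le, ht.2.le⟩
  have hcont : ContinuousOn (fun x : ℝ => (x : ℂ) ^ u * (1 - (x : ℂ)) ^ v) (Set.Icc 0 t) := by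
    refine (continuousOn_of_forall_continuousAt fun x hx => ?_).mul
      (continuousOn_of_forall_continuousAt fun x hx => ?_)
    · refine (continuousAt_cpow_const_of_re_pos (Or.inl ?_) hu).comp continuous_ofReal.continuousAt
      rw [ofReal_re]; exact hx.1
    · refine (continuousAt_cpow_const_of_re_pos (Or.inl ?_) hv).comp
        (f := fun x : ℝ => 1 - (x : ℂ)) (by fun_prop)
      rw [sub_re, one_re, ofReal_re, sub_nonneg]
      exact hx.2.trans ht.2.le
  have hder : ∀ x ∈ Set.Ioo (0 : ℝ) t,
      HasDerivAt (fun x : ℝ => (x : ℂ) ^ u * (1 - (x : ℂ)) ^ v)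
        (u * betaIntegrand u v x - (u + v) * betaIntegrand (u + 1) v x) x := by
    intro x hx
    have hx1 : x < 1 := hx.2.trans ht.2
    have hx0 : (x : ℂ) ≠ 0 := ofReal_ne_zero.2 hx.1.ne'
    have hx1' : (1 - (x : ℂ)) ≠ 0 := by
      rw [sub_ne_zero]; exact_mod_cast hx1.ne'
    have U : HasDerivAt (fun y : ℂ => y ^ u) (u * (x : ℂ) ^ (u - 1)) x := by
      have := (hasDerivAt_id (x : ℂ)).cpow_const (c := u) (Or.inl (by simpa using hx.1))
      simpa using this
    have V : HasDerivAt (fun y : ℂ => (1 - y) ^ v) (-(v * (1 - (x : ℂ)) ^ (v - 1))) x := by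
      have := ((hasDerivAt_id (x : ℂ)).const_sub 1).cpow_const (c := v)
        (Or.inl (by simpa using hx1))
      simpa using this
    have W := (U.mul V).comp_ofReal
    refine W.congr_deriv ?_
    simp only [betaIntegrand, add_sub_cancel_right]
    have e1 : (x : ℂ) ^ u = x ^ (u - 1) * x := by
      rw [cpow_sub _ _ hx0, cpow_one, div_mul_cancel₀ _ hx0]
    have e2 : (1 - (x : ℂ)) ^ v = (1 - (x : ℂ)) ^ (v - 1) * (1 - x) := by
      rw [cpow_sub _ _ hx1', cpow_one, div_mul_cancel₀ _ hx1']
    rw [e1, e2]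
    ring
  have hi := (intervalIntegrable_betaIntegrand hu hv h0 ht').const_mul u
  have hi1 := (intervalIntegrable_betaIntegrand hu1 hv h0 ht').const_mul (u + v)
  have key := intervalIntegral.integral_eq_sub_of_hasDerivAt_of_le ht.1.le hcont hder (hi.sub hi1)
  rw [intervalIntegral.integral_sub hi hi1, intervalIntegral.integral_const_mul,
    intervalIntegral.integral_const_mul] at key
  have hz : ((0 : ℝ) : ℂ) ^ u = 0 := by
    rw [ofReal_zero, zero_cpow]; rintro rfl; simp at hu
  rw [hz, zero_mul, sub_zero] at key
  rw [incompleteBeta, incompleteBeta]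
  linear_combination key

theorem incompleteBeta_expand {p q : ℂ} (hp : 0 < p.re) (hq : 0 < q.re) {t : ℝ}
    (ht : t ∈ Set.Ioo (0 : ℝ) 1) (N : ℕ) :
    p * incompleteBeta p q t =
      (t : ℂ) ^ p * (1 - (t : ℂ)) ^ q *
        ∑ n ∈ Finset.range N, rising (p + q) n / rising (p + 1) n * (t : ℂ) ^ n +
      rising (p + q) N / rising (p + 1) N * (p + N) * incompleteBeta (p + N) q t := by
  induction N with
  | zero => simp [rising_zero]
  | succ N ih =>
    have hp1 : 0 < (p + 1).re := by simp; linarith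
    have hrec := incompleteBeta_recurrence (add_natCast_re_pos hp N) hq ht
    have ht0 : (t : ℂ) ≠ 0 := ofReal_ne_zero.2 ht.1.ne'
    rw [cpow_add _ _ ht0, cpow_natCast] at hrec
    have h1 := rising_ne_zero_of_re_pos hp1 N
    have h2 := add_natCast_ne_zero_of_re_pos hp1 N
    rw [ih, Finset.sum_range_succ, mul_assoc (_ / _) (p + (N : ℂ)), hrec, rising_succ, rising_succ]
    push_cast
    rw [← add_assoc p]
    have h2' : p + N + 1 ≠ 0 := by rwa [add_right_comm]
    have e : rising (p + q) N * (p + q + N) / (rising (p + 1) N * (p + 1 + N)) * (p + N + 1) =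
        rising (p + q) N / rising (p + 1) N * (p + N + q) := by
      rw [add_right_comm p 1] at *
      field_simp
      ring
    rw [e]
    ring

/-- Consecutive terms have ratio t(1 + q/(p+N)), which tends to t < 1. -/
theorem tendsto_rising_ratio_mul_pow {p q : ℂ} (hp : 0 < p.re) (hq : 0 < q.re) {t : ℝ}
    (ht : t ∈ Set.Ioo (0 : ℝ) 1) :
    Tendsto (fun N : ℕ => rising (p + q) N / rising (p + 1) N * (p + N) * (t : ℂ) ^ N)
      atTop (𝓝 0) := by
  have hp1 : 0 < (p + 1).re := by simp; linarith
  have hpq : 0 < (p + q).re := by simp; linarith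
  have ht0 : (t : ℂ) ≠ 0 := ofReal_ne_zero.2 ht.1.ne'
  have hne : ∀ N : ℕ, rising (p + q) N / rising (p + 1) N * (p + N) * (t : ℂ) ^ N ≠ 0 := fun N =>
    mul_ne_zero (mul_ne_zero (div_ne_zero (rising_ne_zero_of_re_pos hpq N)
      (rising_ne_zero_of_re_pos hp1 N)) (add_natCast_ne_zero_of_re_pos hp N)) (pow_ne_zero _ ht0)
  refine (summable_of_ratio_test_tendsto_lt_one ht.2 (.of_forall hne) ?_).tendsto_atTop_zero
  have h1 : Tendsto (fun N : ℕ => (1 + q * (p + N)⁻¹) * (t : ℂ)) atTop (𝓝 ((1 + q * 0) * t)) := by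
    refine ((Tendsto.const_mul q (tendsto_inv₀_cobounded.comp ?_)).const_add 1).mul_const _
    have : Tendsto (fun N : ℕ => (N : ℂ)) atTop (Bornology.cobounded ℂ) := by
      rw [← tendsto_norm_atTop_iff_cobounded]
      simpa using tendsto_natCast_atTop_atTop (R := ℝ)
    exact (tendsto_const_add_cobounded p).comp this
  have h2 := h1.norm
  have e : ‖(1 + q * 0) * (t : ℂ)‖ = t := by
    rw [mul_zero, add_zero, one_mul, norm_real, Real.norm_of_nonneg ht.1.le]
  rw [e] at h2
  refine h2.congr fun N => ?_
  rw [← norm_div]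
  congr 1
  have a1 := rising_ne_zero_of_re_pos hpq N
  have a2 := rising_ne_zero_of_re_pos hp1 N
  have a3 := add_natCast_ne_zero_of_re_pos hp1 N
  have a4 := add_natCast_ne_zero_of_re_pos hp N
  rw [rising_succ, rising_succ, pow_succ]
  push_cast
  rw [← add_assoc p]
  rw [add_right_comm p 1] at *
  field_simp
  ring

theorem norm_incompleteBeta_add_natCast_le {p q : ℂ} (hp : 0 < p.re) (hq : 0 < q.re) {t : ℝ}
    (ht : t ∈ Set.Ioo (0 : ℝ) 1) (N : ℕ) :
    ‖incompleteBeta (p + N) q t‖ ≤ t ^ N * ∫ x : ℝ in 0..t, ‖betaIntegrand p q x‖ := by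
  have h0 : (0 : ℝ) ∈ Set.Icc (0 : ℝ) 1 := by simp
  have ht' : t ∈ Set.Icc (0 : ℝ) 1 := ⟨ht.1.le, ht.2.le⟩
  refine (intervalIntegral.norm_integral_le_integral_norm ht.1.le).trans ?_
  rw [← intervalIntegral.integral_const_mul]
  refine intervalIntegral.integral_mono_on_of_le_Ioo ht.1.le
    (intervalIntegrable_betaIntegrand (add_natCast_re_pos hp N) hq h0 ht').norm
    ((intervalIntegrable_betaIntegrand hp hq h0 ht').norm.const_mul _) fun x hx => ?_
  have hx0 : (x : ℂ) ≠ 0 := ofReal_ne_zero.2 hx.1.ne'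
  rw [betaIntegrand, betaIntegrand, show p + N - 1 = p - 1 + N by ring, cpow_add _ _ hx0,
    cpow_natCast, norm_mul, norm_mul, norm_mul, norm_pow, norm_real, Real.norm_of_nonneg hx.1.le,
    mul_comm (‖(x : ℂ) ^ (p - 1)‖), mul_assoc]
  gcongr
  exacts [hx.1.le, hx.2.le]

theorem tsum_rising_ratio_mul_pow {p q : ℂ} (hp : 0 < p.re) (hq : 0 < q.re) {t : ℝ}
    (ht : t ∈ Set.Ioo (0 : ℝ) 1) (S : Summable fun n : ℕ =>
      rising (p + q) n / rising (p + 1) n * (t : ℂ) ^ n) :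
    (t : ℂ) ^ p * (1 - (t : ℂ)) ^ q * ∑' n : ℕ, rising (p + q) n / rising (p + 1) n * (t : ℂ) ^ n =
      p * incompleteBeta p q t := by
  have hrem : Tendsto (fun N : ℕ => rising (p + q) N / rising (p + 1) N * (p + N) *
      incompleteBeta (p + N) q t) atTop (𝓝 0) := by
    have h := (tendsto_rising_ratio_mul_pow hp hq ht).norm.mul_const
      (∫ x : ℝ in 0..t, ‖betaIntegrand p q x‖)
    rw [norm_zero, zero_mul] at h
    refine squeeze_zero_norm (fun N => ?_) h
    rw [norm_mul, norm_mul _ ((t : ℂ) ^ N), mul_assoc, norm_pow, norm_real,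
      Real.norm_of_nonneg ht.1.le]
    gcongr
    exact norm_incompleteBeta_add_natCast_le hp hq ht N
  have h := (S.hasSum.tendsto_sum_nat.const_mul ((t : ℂ) ^ p * (1 - (t : ℂ)) ^ q)).add hrem
  rw [add_zero] at h
  refine tendsto_nhds_unique h (tendsto_const_nhds.congr fun N => ?_)
  exact incompleteBeta_expand hp hq ht N

theorem summable_rising_ratio_mul_pow {p q : ℂ} (hp : 0 < p.re) (hq : 0 < q.re) {t : ℝ}
    (ht : t ∈ Set.Ioo (0 : ℝ) 1) :
    Summable fun n : ℕ => rising (p + q) n / rising (p + 1) n * (t : ℂ) ^ n := by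
  -- At an intermediate s the terms weighted by p + n are bounded, so those at t are dominated by a
  -- multiple of (t/s)^n.
  obtain ⟨s, hts, hs1⟩ := exists_between ht.2
  have hs0 : 0 < s := ht.1.trans hts
  have h := (tendsto_rising_ratio_mul_pow hp hq ⟨hs0, hs1⟩).norm.bddAbove_range
  obtain ⟨M, hM⟩ := h
  have hg := (summable_geometric_of_lt_one (div_nonneg ht.1.le hs0.le)
    ((div_lt_one hs0).2 hts)).mul_left (M / p.re)
  refine Summable.of_norm_bounded hg fun n => ?_
  have hMn : ‖rising (p + q) n / rising (p + 1) n * (p + n) * (s : ℂ) ^ n‖ ≤ M := hM ⟨n, rfl⟩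
  rw [norm_mul, norm_mul, norm_pow, norm_real, Real.norm_of_nonneg hs0.le] at hMn
  have hpn : p.re ≤ ‖p + n‖ := by
    refine le_trans ?_ (re_le_norm _)
    simp
  rw [norm_mul, norm_pow, norm_real, Real.norm_of_nonneg ht.1.le, div_pow]
  have h1 : ‖rising (p + q) n / rising (p + 1) n‖ * (p.re * s ^ n) ≤ M := by
    refine le_trans ?_ hMn
    rw [mul_assoc]
    gcongr
  calc ‖rising (p + q) n / rising (p + 1) n‖ * t ^ n
      = ‖rising (p + q) n / rising (p + 1) n‖ * (p.re * s ^ n) * (t ^ n / (p.re * s ^ n)) := by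
        field_simp
    _ ≤ M * (t ^ n / (p.re * s ^ n)) := by
        have := ht.1
        gcongr
    _ = _ := by field_simp

theorem hasSum_betaIntegrand {p q : ℂ} (hp : 0 < p.re) (hq : 0 < q.re) {t : ℝ}
    (ht : t ∈ Set.Ioo (0 : ℝ) 1) :
    HasSum (fun n : ℕ => rising (p + q) n / rising (p + 1) n / p *
      betaIntegrand (p + q + n) (p + q) t) (betaIntegrand q p t * incompleteBeta p q t) := by
  have S := summable_rising_ratio_mul_pow hp hq ht
  have e := tsum_rising_ratio_mul_pow hp hq ht S
  have hp0 : p ≠ 0 := by rintro rfl; simp at hp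
  have ht0 : (t : ℂ) ≠ 0 := ofReal_ne_zero.2 ht.1.ne'
  have ht1 : (1 - (t : ℂ)) ≠ 0 := by
    rw [sub_ne_zero]; exact_mod_cast ht.2.ne'
  have h := S.hasSum.mul_left (betaIntegrand q p t * ((t : ℂ) ^ p * (1 - (t : ℂ)) ^ q) / p)
  have e' : betaIntegrand q p t * ((t : ℂ) ^ p * (1 - (t : ℂ)) ^ q) / p *
      ∑' n : ℕ, rising (p + q) n / rising (p + 1) n * (t : ℂ) ^ n =
        betaIntegrand q p t * incompleteBeta p q t := by
    rw [mul_div_right_comm, mul_assoc, e]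
    field_simp
  rw [e'] at h
  refine h.congr_fun fun n => ?_
  simp only [betaIntegrand]
  rw [show p + q + n - 1 = p + (q - 1) + n by ring, show p + q - 1 = q + (p - 1) by ring,
    cpow_add _ _ ht0, cpow_add _ _ ht0, cpow_add _ _ ht1, cpow_natCast]
  ring

/-! ### A relation between two ₃F₂ series -/

theorem integral_norm_betaIntegrand_eq {u v : ℂ} (hu : 0 < u.re) (hv : 0 < v.re) (n : ℕ) :
    ∫ x : ℝ in 0..1, ‖betaIntegrand (u + n) v x‖ =
      ‖betaIntegral u.re v.re‖ * ‖rising u.re n / rising (u.re + v.re) n‖ := by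
  have h := norm_betaIntegral_ofReal (u.re + n) v.re
  have e := betaIntegral_add_natCast (u := u.re) (v := v.re) (by simpa) (by simpa) n 0
  simp only [Nat.cast_zero, add_zero, rising_zero, mul_one] at e
  push_cast at h
  rw [← norm_mul, ← e, h]
  have := integral_norm_betaIntegrand (u + n) v
  simpa only [betaIntegrand, add_re, natCast_re] using this

theorem summable_integral_norm {p q : ℂ} (hp : 0 < p.re) (hq : 0 < q.re) :
    Summable fun n : ℕ => ‖rising (p + q) n / rising (p + 1) n / p‖ *
      ∫ x : ℝ in 0..1, ‖betaIntegrand (p + q + n) (p + q) x‖ := by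
  have hpq : 0 < (p + q).re := by simp; linarith
  -- Taking norms inside the integral replaces the Beta parameters by their real parts but leaves
  -- the coefficient complex. The excess of the mixed series has real part 1 + Re p.
  have hs := summable_hypTerm (x₁ := p + q) (x₂ := (p + q).re) (y₁ := p + 1)
    (y₂ := (p + q).re + (p + q).re)
    (add_natCast_ne_zero_of_re_pos (by simp; linarith))
    (add_natCast_ne_zero_of_re_pos (by simp; linarith)) (by simp; linarith)
  refine (hs.norm.mul_left (‖betaIntegral (p + q).re (p + q).re‖ / ‖p‖)).congr fun n => ?_
  rw [integral_norm_betaIntegrand_eq hpq hpq, hypTerm, norm_div _ p, mul_div_mul_comm, norm_mul]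
  ring

theorem betaIntegrand_swap (u v : ℂ) (x : ℝ) : betaIntegrand u v (1 - x) = betaIntegrand v u x := by
  simp only [betaIntegrand]
  push_cast
  rw [sub_sub_cancel, mul_comm]

theorem integral_norm_betaIntegrand_swap (u v : ℂ) :
    ∫ x : ℝ in 0..1, ‖betaIntegrand u v x‖ = ∫ x : ℝ in 0..1, ‖betaIntegrand v u x‖ := by
  have := intervalIntegral.integral_comp_sub_left (a := 0) (b := 1)
    (fun x => ‖betaIntegrand u v x‖) 1
  simp only [betaIntegrand_swap, sub_self, sub_zero] at this
  exact this.symm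

theorem betaIntegral_mul_hypTerm {p q : ℂ} (hp : 0 < p.re) (hq : 0 < q.re) (n : ℕ) :
    rising (p + q) n / rising (p + 1) n / p * betaIntegral (p + q + n) (p + q) =
      betaIntegral (p + q) (p + q) / p *
        hypTerm (p + q) (p + q) (p + 1) (2 * (p + q)) n := by
  have hpq : 0 < (p + q).re := by simp; linarith
  have e := betaIntegral_add_natCast hpq hpq n 0
  simp only [Nat.cast_zero, add_zero, rising_zero, mul_one] at e
  rw [e, hypTerm, mul_div_mul_comm, two_mul]
  ring

theorem tsum_hypTerm_add_tsum_hypTerm {p q : ℂ} (hp : 0 < p.re) (hq : 0 < q.re) :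
    (∑' n, hypTerm (p + q) (p + q) (p + 1) (2 * (p + q)) n) / p +
      (∑' n, hypTerm (p + q) (p + q) (q + 1) (2 * (p + q)) n) / q =
        betaIntegral p q ^ 2 / betaIntegral (p + q) (p + q) := by
  have hpq : 0 < (p + q).re := by simp; linarith
  have h0 : (0 : ℝ) ∈ Set.Icc (0 : ℝ) 1 := by simp
  have h1 : (1 : ℝ) ∈ Set.Icc (0 : ℝ) 1 := by simp
  set A : ℕ → ℂ := fun n => rising (p + q) n / rising (p + 1) n / p
  set B : ℕ → ℂ := fun n => rising (p + q) n / rising (q + 1) n / q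
  -- The second family is the expansion at 1 − x, reflected back to x. Pairing both expansions makes
  -- the pointwise sum a constant multiple of a Beta integrand, since the two incomplete integrals
  -- add up to B(p,q).
  set F : ℕ → ℝ → ℂ := fun n x => A n * betaIntegrand (p + q + n) (p + q) x +
    B n * betaIntegrand (p + q) (p + q + n) x
  have hiA (n : ℕ) := (intervalIntegrable_betaIntegrand (add_natCast_re_pos hpq n) hpq h0 h1)
  have hiB (n : ℕ) := (intervalIntegrable_betaIntegrand hpq (add_natCast_re_pos hpq n) h0 h1)
  have hF (n : ℕ) : IntervalIntegrable (F n) MeasureTheory.volume 0 1 :=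
    ((hiA n).const_mul (A n)).add ((hiB n).const_mul (B n))
  have hsA := summable_integral_norm hp hq
  have hsB := summable_integral_norm hq hp
  rw [add_comm q p] at hsB
  have hsum : Summable fun n => ∫ x : ℝ in 0..1, ‖F n x‖ := by
    refine Summable.of_nonneg_of_le (fun n => intervalIntegral.integral_nonneg zero_le_one
      fun _ _ => norm_nonneg _) (fun n => ?_) (hsA.add hsB)
    have e := integral_norm_betaIntegrand_swap (p + q + n) (p + q)
    calc _ ≤ ∫ x : ℝ in 0..1, (‖A n‖ * ‖betaIntegrand (p + q + n) (p + q) x‖ +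
          ‖B n‖ * ‖betaIntegrand (p + q) (p + q + n) x‖) := ?_
      _ = _ := by
        rw [intervalIntegral.integral_add ((hiA n).norm.const_mul _) ((hiB n).norm.const_mul _),
          intervalIntegral.integral_const_mul, intervalIntegral.integral_const_mul, ← e]
    refine intervalIntegral.integral_mono_on zero_le_one (hF n).norm
      (((hiA n).norm.const_mul _).add ((hiB n).norm.const_mul _)) fun x _ => ?_
    refine (norm_add_le _ _).trans ?_
    rw [norm_mul, norm_mul]
  have hint (n : ℕ) : ∫ x : ℝ in 0..1, F n x =
      betaIntegral (p + q) (p + q) / p * hypTerm (p + q) (p + q) (p + 1) (2 * (p + q)) n +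
      betaIntegral (p + q) (p + q) / q * hypTerm (p + q) (p + q) (q + 1) (2 * (p + q)) n := by
    have e₁ : ∫ x : ℝ in 0..1, betaIntegrand (p + q + n) (p + q) x =
      betaIntegral (p + q + n) (p + q) := rfl
    have e₂ : ∫ x : ℝ in 0..1, betaIntegrand (p + q) (p + q + n) x =
      betaIntegral (p + q + n) (p + q) := betaIntegral_symm (p + q + n) (p + q)
    have hB := betaIntegral_mul_hypTerm hq hp n
    rw [add_comm q p] at hB
    rw [intervalIntegral.integral_add ((hiA n).const_mul _) ((hiB n).const_mul _),
      intervalIntegral.integral_const_mul, intervalIntegral.integral_const_mul,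
      ← betaIntegral_mul_hypTerm hp hq, ← hB, e₁, e₂]
  have hlim : ∫ x : ℝ in 0..1, ∑' n, F n x = betaIntegral p q ^ 2 := by
    have e : ∫ x : ℝ in 0..1, ∑' n, F n x =
        ∫ x : ℝ in 0..1, betaIntegral p q * betaIntegrand q p x := by
      rw [intervalIntegral.integral_of_le zero_le_one, intervalIntegral.integral_of_le zero_le_one,
        MeasureTheory.integral_Ioc_eq_integral_Ioo, MeasureTheory.integral_Ioc_eq_integral_Ioo]
      refine MeasureTheory.setIntegral_congr_fun measurableSet_Ioo fun x hx => ?_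
      have hx' : 1 - x ∈ Set.Ioo (0 : ℝ) 1 := ⟨by linarith [hx.2], by linarith [hx.1]⟩
      have hA := hasSum_betaIntegrand hp hq hx
      have hB := hasSum_betaIntegrand hq hp hx'
      simp only [betaIntegrand_swap, add_comm q p] at hB
      refine (hA.add hB).tsum_eq.trans ?_
      rw [← incompleteBeta_add hp hq ⟨hx.1.le, hx.2.le⟩]
      ring
    rw [e, intervalIntegral.integral_const_mul, sq]
    exact congrArg _ (betaIntegral_symm p q)
  have key : HasSum (fun n => ∫ x : ℝ in 0..1, F n x) (∫ x : ℝ in 0..1, ∑' n, F n x) := by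
    simp only [intervalIntegral.integral_of_le (zero_le_one' ℝ)] at hsum ⊢
    exact MeasureTheory.hasSum_integral_of_summable_integral_norm
      (fun n => (intervalIntegrable_iff_integrableOn_Ioc_of_le zero_le_one).1 (hF n)) hsum
  rw [hlim] at key
  simp only [hint] at key
  have s₁ : Summable (hypTerm (p + q) (p + q) (p + 1) (2 * (p + q))) :=
    summable_hypTerm (add_natCast_ne_zero_of_re_pos (by simp; linarith))
      (add_natCast_ne_zero_of_re_pos (by rw [two_mul, add_re]; linarith)) (by simp; linarith)
  have s₂ : Summable (hypTerm (p + q) (p + q) (q + 1) (2 * (p + q))) :=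
    summable_hypTerm (add_natCast_ne_zero_of_re_pos (by simp; linarith))
      (add_natCast_ne_zero_of_re_pos (by rw [two_mul, add_re]; linarith)) (by simp; linarith)
  have h := key.unique ((s₁.hasSum.mul_left _).add (s₂.hasSum.mul_left _))
  have hb := betaIntegral_ne_zero hpq hpq
  rw [h]
  field_simp

/-! ### The second identity and its analytic continuation -/

/-- The Gamma-quotient term of the second identity. -/
noncomputable def gammaPart (a : ℂ) : ℂ :=
  16 / (Real.pi : ℂ) * ((64 : ℂ) ^ a / Complex.cos ((Real.pi : ℂ) * a) ^ 2)
    * (risingGamma 1 a ^ 3 / risingGamma (1 / 2) a ^ 3)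

theorem two_cpow_two_mul_pow_three (a : ℂ) : ((2 : ℂ) ^ (2 * a)) ^ 3 = (64 : ℂ) ^ a := by
  have h : (64 : ℂ) = ((2 : ℝ) ^ 6 : ℝ) := by norm_num
  rw [h, ← cpow_nat_mul, cpow_def_of_ne_zero two_ne_zero, cpow_def_of_ne_zero
    (by exact_mod_cast (by positivity : (2 : ℝ) ^ 6 ≠ 0)), ← ofReal_log (by positivity),
    Real.log_pow, ← ofReal_ofNat, ← ofReal_log (by positivity)]
  push_cast
  ring_nf

theorem ofReal_sqrt_pi_sq : ((√Real.pi : ℝ) : ℂ) ^ 2 = Real.pi := by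
  rw [← ofReal_pow, Real.sq_sqrt Real.pi_pos.le]

theorem Gamma_half_add_mul_Gamma_half_sub (a : ℂ) :
    Gamma (1 / 2 + a) * Gamma (1 / 2 - a) = Real.pi / cos (Real.pi * a) := by
  have h := Gamma_mul_Gamma_one_sub (1 / 2 + a)
  rw [show 1 - (1 / 2 + a) = 1 / 2 - a by ring,
    show (Real.pi : ℂ) * (1 / 2 + a) = Real.pi * a + Real.pi / 2 by ring, sin_add_pi_div_two] at h
  exact h

/-- Duplication at 1/2 + a eliminates Γ(2a), reflection eliminates Γ(1/2 − a), and the cube of the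
duplication factor 2^(2a) is 64^a. -/
theorem beta_eq_gammaPart {a : ℂ} (h0 : 0 < a.re) (h1 : a.re < 1 / 2) :
    64 * a ^ 2 * (betaIntegral (2 * a) (1 / 2 - a) ^ 2 /
      betaIntegral (1 / 2 + a) (1 / 2 + a)) = gammaPart a := by
  have ha0 : a ≠ 0 := by rintro rfl; simp at h0
  have hm : 0 < (1 / 2 + a).re := by norm_num; linarith
  have hp : 0 < (2 * a).re := by simp; linarith
  have hq : 0 < (1 / 2 - a).re := by norm_num; linarith
  have hr := Gamma_half_add_mul_Gamma_half_sub a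
  have hd := Gamma_mul_Gamma_add_half (1 / 2 + a)
  rw [show 1 / 2 + a + 1 / 2 = 1 + a by ring, show 2 * (1 / 2 + a) = 2 * a + 1 by ring,
    Gamma_add_one _ (mul_ne_zero two_ne_zero ha0), show 1 - (2 * a + 1) = -(2 * a) by ring,
    cpow_neg] at hd
  rw [betaIntegral_eq_Gamma hp hq, betaIntegral_eq_Gamma hm hm,
    show 2 * a + (1 / 2 - a) = 1 / 2 + a by ring, show 1 / 2 + a + (1 / 2 + a) = 2 * a + 1 by ring,
    Gamma_add_one _ (mul_ne_zero two_ne_zero ha0), gammaPart, risingGamma, risingGamma, Gamma_one,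
    div_one, Gamma_one_half_eq, ← two_cpow_two_mul_pow_three]
  have hs := ofReal_sqrt_pi_sq
  have hpi : (Real.pi : ℂ) ^ (1 / 2 : ℂ) = (√Real.pi : ℝ) := by
    rw [Real.sqrt_eq_rpow, ofReal_cpow Real.pi_pos.le]; norm_num
  rw [hpi]
  have hs0 : ((√Real.pi : ℝ) : ℂ) ≠ 0 := by
    exact_mod_cast (Real.sqrt_pos.2 Real.pi_pos).ne'
  have h2 : (2 : ℂ) ^ (2 * a) ≠ 0 := by simp [cpow_eq_zero_iff]
  have g1 := Gamma_ne_zero_of_re_pos hm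
  have g2 := Gamma_ne_zero_of_re_pos hq
  have hc : cos (Real.pi * a) ≠ 0 := by
    intro h
    rw [h, div_zero] at hr
    exact mul_ne_zero g1 g2 hr
  generalize cos (Real.pi * a) = c at *
  generalize ((√Real.pi : ℝ) : ℂ) = s at *
  rw [← hs] at hr ⊢
  generalize (2 : ℂ) ^ (2 * a) = T at *
  generalize Gamma (1 / 2 + a) = G at *
  generalize Gamma (1 / 2 - a) = K at *
  generalize Gamma (1 + a) = L at *
  generalize Gamma (2 * a) = M at *
  have hM : M = G * L * T / (2 * a * s) := by
    rw [eq_div_iff (mul_ne_zero (mul_ne_zero two_ne_zero ha0) hs0)]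
    field_simp at hd
    linear_combination -hd
  have hK : K = s ^ 2 / (c * G) := by
    field_simp
    field_simp at hr
    linear_combination hr
  rw [hM, hK]
  field_simp
  ring

theorem ramanujanF_eq_of_mem_strip {a : ℂ} (h0 : 0 < a.re) (h1 : a.re < 1 / 2) :
    ramanujanF a = gammaPart a + 128 * a ^ 2 / (2 * a - 1) * ∑' n, secondTerm a n := by
  have ha0 : a ≠ 0 := by rintro rfl; simp at h0
  have hp : 0 < (2 * a).re := by simp; linarith
  have hq : 0 < (1 / 2 - a).re := by norm_num; linarith
  have hq0 : 1 / 2 - a ≠ 0 := by intro h; rw [h] at hq; simp at hq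
  have h := tsum_hypTerm_add_tsum_hypTerm hp hq
  rw [show 2 * a + (1 / 2 - a) = 1 / 2 + a by ring, show 2 * (1 / 2 + a) = 2 * a + 1 by ring,
    show 1 / 2 - a + 1 = 3 / 2 - a by ring] at h
  have e₁ : ∑' n, hypTerm (1 / 2 + a) (1 / 2 + a) (2 * a + 1) (2 * a + 1) n =
      ∑' n, firstTerm a n := by
    rw [firstTerm_eq_hypTerm, add_comm a]
  have e₂ : ∑' n, hypTerm (1 / 2 + a) (1 / 2 + a) (3 / 2 - a) (2 * a + 1) n =
      ∑' n, secondTerm a n := by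
    rw [secondTerm_eq_hypTerm, add_comm a]
    exact tsum_congr fun n => by simp only [hypTerm]; rw [mul_comm (rising (3 / 2 - a) n)]
  rw [e₁, e₂] at h
  rw [ramanujanF_eq_tsum_firstTerm h0, ← beta_eq_gammaPart h0 h1, ← h]
  have hq2 : 2 * a - 1 ≠ 0 := by
    intro h; apply hq0; linear_combination -h / 2
  have : 1 / 2 - a = -((2 * a - 1) / 2) := by ring
  rw [this]
  field_simp
  ring

theorem differentiableAt_gammaPart {a : ℂ} (ha : a.re < 1 / 2)
    (h : ∀ m : ℕ, 2 * a ≠ -((m : ℂ) + 1)) : DifferentiableAt ℂ gammaPart a := by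
  -- A zero of the cosine would make 2a an odd integer 2k + 1; Re a < 1/2 forces k < 0, and these
  -- values are excluded by h.
  have hc : cos (Real.pi * a) ≠ 0 := by
    rw [Ne, cos_eq_zero_iff]
    rintro ⟨k, hk⟩
    have hpi : (Real.pi : ℂ) ≠ 0 := ofReal_ne_zero.2 Real.pi_ne_zero
    have e : 2 * a = 2 * k + 1 := by
      refine mul_left_cancel₀ hpi ?_
      linear_combination 2 * hk
    have hre := congrArg re e
    simp at hre
    have hk0 : k < 0 := by
      have : (k : ℝ) < 0 := by linarith
      exact_mod_cast this
    obtain ⟨m, hm⟩ : ∃ m : ℕ, k = -(m + 1) := ⟨(-k - 1).toNat, by omega⟩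
    apply h (2 * m)
    rw [e, hm]; push_cast; ring
  have g1 : ∀ m : ℕ, 1 + a ≠ -m := fun m hm => h (2 * m + 1) (by
    push_cast; linear_combination 2 * hm)
  have g2 : ∀ m : ℕ, 1 / 2 + a ≠ -m := fun m hm => h (2 * m) (by
    push_cast; linear_combination 2 * hm)
  have hg2 : Gamma (1 / 2 + a) ≠ 0 := Gamma_ne_zero g2
  have d1 : DifferentiableAt ℂ (fun w => Gamma (1 + w)) a :=
    (differentiableAt_Gamma _ g1).comp (f := fun w => 1 + w) a (by fun_prop)
  have d2 : DifferentiableAt ℂ (fun w => Gamma (1 / 2 + w)) a :=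
    (differentiableAt_Gamma _ g2).comp (f := fun w => 1 / 2 + w) a (by fun_prop)
  have hg : Gamma (1 / 2) ≠ 0 := Gamma_ne_zero_of_re_pos (by norm_num)
  unfold gammaPart risingGamma
  refine DifferentiableAt.mul (DifferentiableAt.const_mul (DifferentiableAt.div
    (c := fun w : ℂ => (64 : ℂ) ^ w) (d := fun w : ℂ => cos (Real.pi * w) ^ 2) ?_ ?_
    (pow_ne_zero 2 hc)) _) (DifferentiableAt.div ((d1.div_const _).pow 3) ((d2.div_const _).pow 3)
    (pow_ne_zero 3 (div_ne_zero hg2 hg)))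
  · exact DifferentiableAt.const_cpow differentiableAt_id (Or.inl (by norm_num))
  · fun_prop

/-- The difference of the two sides of the second identity. -/
noncomputable def secondDefect (a : ℂ) : ℂ :=
  ramanujanF a - (gammaPart a + 128 * a ^ 2 / (2 * a - 1) * ∑' n, secondTerm a n)

theorem two_mul_sub_one_ne_zero {a : ℂ} (ha : a.re < 1 / 2) : 2 * a - 1 ≠ 0 := by
  intro h
  have := congrArg re h
  simp at this
  linarith

theorem ne_of_two_mul_ne {a : ℂ} (h : ∀ m : ℕ, 2 * a ≠ -((m : ℂ) + 1)) (m : ℕ) :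
    a ≠ -((m : ℂ) + 1) := fun hm => h (2 * m + 1) (by push_cast; linear_combination 2 * hm)

theorem differentiableAt_secondDefect {a : ℂ} (ha : a.re < 1 / 2)
    (h : ∀ m : ℕ, 2 * a ≠ -((m : ℂ) + 1)) : DifferentiableAt ℂ secondDefect a := by
  refine (differentiableAt_ramanujanF (ne_of_two_mul_ne h)).sub
    ((differentiableAt_gammaPart ha h).add (DifferentiableAt.mul ?_
      (differentiableAt_tsum_secondTerm ha h)))
  exact DifferentiableAt.div (by fun_prop) (by fun_prop) (two_mul_sub_one_ne_zero ha)

theorem two_mul_ne_of_im_ne_zero {a : ℂ} (h : a.im ≠ 0) (m : ℕ) : 2 * a ≠ -((m : ℂ) + 1) := by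
  intro hm
  have := congrArg im hm
  simp at this
  exact h this

/-- All excluded points are real, so cutting along the real axis leaves two convex regions, selected
by the sign of s. Each meets the strip 0 < Re z < 1/2, where the identity is known, and the identity
theorem applies. -/
theorem secondDefect_eq_zero_of_im {s : ℝ} {a : ℂ} (ha : a.re < 1 / 2) (him : 0 < s * a.im) :
    secondDefect a = 0 := by
  set U : Set ℂ := {z | z.re < 1 / 2} ∩ {z | 0 < s * z.im}
  have hs : s ≠ 0 := by rintro rfl; simp at him
  have hUo : IsOpen U := by
    refine IsOpen.inter (isOpen_lt continuous_re continuous_const)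
      (isOpen_lt continuous_const (continuous_const.mul continuous_im))
  have hUc : Convex ℝ U := by
    refine (convex_halfSpace_re_lt (1 / 2)).inter ?_
    exact convex_halfSpace_gt (f := fun z : ℂ => s * z.im)
      ⟨fun x y => by simp [mul_add], fun c x => by simp; ring⟩ 0
  have hUd : DifferentiableOn ℂ secondDefect U := fun z hz =>
    (differentiableAt_secondDefect hz.1 (two_mul_ne_of_im_ne_zero (by
      have : 0 < s * z.im := hz.2
      rintro h; simp [h] at this))).differentiableWithinAt
  have hz : (⟨1 / 4, s⟩ : ℂ) ∈ U := ⟨by norm_num, by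
    exact mul_self_pos.2 hs⟩
  refine (hUd.analyticOnNhd hUo).eqOn_zero_of_preconnected_of_eventuallyEq_zero
    hUc.isPreconnected hz ?_ ⟨ha, him⟩
  have ho : IsOpen {z : ℂ | 0 < z.re ∧ z.re < 1 / 2} :=
    (isOpen_lt continuous_const continuous_re).inter (isOpen_lt continuous_re continuous_const)
  filter_upwards [ho.mem_nhds (x := (⟨1 / 4, s⟩ : ℂ)) ⟨by norm_num, by norm_num⟩] with z hz
  simp only [secondDefect, Pi.zero_apply]
  rw [ramanujanF_eq_of_mem_strip hz.1 hz.2, sub_self]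

theorem secondDefect_eq_zero {a : ℂ} (ha : a.re < 1 / 2)
    (h : ∀ m : ℕ, 2 * a ≠ -((m : ℂ) + 1)) : secondDefect a = 0 := by
  have hc := (differentiableAt_secondDefect ha h).continuousAt
  by_cases him : a.im = 0
  -- Real points are reached as limits from the upper half plane, by continuity of the defect.
  · have ht : Tendsto (fun t : ℝ => a + t * I) (𝓝[>] 0) (𝓝 a) := by
      have : Continuous fun t : ℝ => a + t * I := by fun_prop
      have := this.tendsto 0
      simp only [ofReal_zero, zero_mul, add_zero] at this
      exact this.mono_left nhdsWithin_le_nhds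
    refine tendsto_nhds_unique (hc.tendsto.comp ht) (tendsto_const_nhds.congr' ?_)
    filter_upwards [self_mem_nhdsWithin] with t ht
    refine (secondDefect_eq_zero_of_im (s := 1) ?_ ?_).symm
    · simpa using ha
    · simpa [him] using ht
  · exact secondDefect_eq_zero_of_im ha (s := a.im) (mul_self_pos.2 him)

theorem ramanujanF_eq_gammaPart_add {a : ℂ} (ha : a.re < 1 / 2)
    (h : ∀ m : ℕ, 2 * a ≠ -((m : ℂ) + 1)) :
    ramanujanF a = gammaPart a + 128 * a ^ 2 / (2 * a - 1) * ∑' n, secondTerm a n :=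
  sub_eq_zero.1 (secondDefect_eq_zero ha h)

theorem two_mul_ne_of_re_gt {a : ℂ} (ha : -(1 / 2) < a.re) (m : ℕ) : 2 * a ≠ -((m : ℂ) + 1) := by
  intro hm
  have := congrArg re hm
  simp at this
  have : (0 : ℝ) ≤ m := Nat.cast_nonneg m
  linarith

/-! ### Special values -/

theorem ramanujanF_one_half : ramanujanF (1 / 2) = 8 * (Real.pi : ℂ) ^ 2 / 3 := by
  rw [ramanujanF_eq_tsum_firstTerm (by norm_num)]
  have e (n : ℕ) : firstTerm (1 / 2) n = ((1 / ((n + 1 : ℕ) : ℝ) ^ 2 : ℝ) : ℂ) := by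
    have h := rising_shift 1 n
    have h1 := rising_ne_zero_of_re_pos (x := 1) (by simp) n
    have hn : (1 : ℂ) + n ≠ 0 := add_natCast_ne_zero_of_re_pos (by simp) n
    rw [mul_one] at h
    rw [firstTerm, show (1 / 2 + 1 / 2 : ℂ) = 1 by norm_num,
      show (2 * (1 / 2) + 1 : ℂ) = 1 + 1 by norm_num, h]
    push_cast
    rw [add_comm (n : ℂ)]
    field_simp
  have hz := hasSum_zeta_two
  rw [← hasSum_nat_add_iff' 1] at hz
  have hz' : HasSum (fun n : ℕ => (1 / ((n + 1 : ℕ) : ℝ) ^ 2)) (Real.pi ^ 2 / 6) := by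
    simpa using hz
  have : ∑' n, firstTerm (1 / 2) n = ((Real.pi ^ 2 / 6 : ℝ) : ℂ) := by
    simp_rw [e]
    exact (hasSum_ofReal.2 hz').tsum_eq
  rw [this]
  push_cast
  ring

theorem gammaPart_zero : gammaPart 0 = 16 / (Real.pi : ℂ) := by
  have hg : Gamma (1 / 2) ≠ 0 := Gamma_ne_zero_of_re_pos (by norm_num)
  simp only [gammaPart, risingGamma, add_zero, mul_zero, cos_zero, cpow_zero, div_self hg, Gamma_one]
  norm_num

theorem ramanujanF_zero : ramanujanF 0 = 16 / (Real.pi : ℂ) := by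
  rw [ramanujanF_eq_gammaPart_add (by norm_num) (two_mul_ne_of_re_gt (by norm_num)), gammaPart_zero]
  simp

theorem hasSum_rising_half_mul_pow {t : ℝ} (ht : t ∈ Set.Ioo (0 : ℝ) 1) :
    HasSum (fun n : ℕ => rising (1 / 2) n / rising 1 n * (t : ℂ) ^ n)
      ((1 - (t : ℂ)) ^ (-(1 / 2) : ℂ)) := by
  have h := (one_div_one_sub_cpow_hasFPowerSeriesOnBall_zero (1 / 2)).hasSum (y := (t : ℂ)) (by
    rw [← ENNReal.ofReal_one, Metric.eball_ofReal, mem_ball_zero_iff, norm_real,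
      Real.norm_of_nonneg ht.1.le]
    exact ht.2)
  rw [zero_add, one_div ((1 - (t : ℂ)) ^ _), ← cpow_neg] at h
  refine h.congr_fun fun n => ?_
  have hc : (n.factorial : ℂ) * Ring.choose ((1 / 2 : ℂ) + n - 1) n = rising (1 / 2) n := by
    rw [← Ring.multichoose_eq, ← nsmul_eq_mul, Ring.factorial_nsmul_multichoose_eq_ascPochhammer,
      Polynomial.ascPochhammer_smeval_eq_eval, rising]
  have hf : (n.factorial : ℂ) ≠ 0 := by exact_mod_cast n.factorial_ne_zero
  rw [rising_one, ← hc, mul_div_cancel_left₀ _ hf]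
  simp [mul_comm]

/-- This is the arcsine series at 1. The factor (1/2)_n/(3/2)_n is half the integral of x^(n−1/2),
and the binomial series of (1−x)^(−1/2) sums the integrand, giving B(1/2,1/2)/2. -/
theorem tsum_secondTerm_zero : ∑' n, secondTerm 0 n = (Real.pi : ℂ) / 2 := by
  have h0 : (0 : ℝ) ∈ Set.Icc (0 : ℝ) 1 := by simp
  have h1 : (1 : ℝ) ∈ Set.Icc (0 : ℝ) 1 := by simp
  have hh : 0 < (1 / 2 : ℂ).re := by norm_num
  have h1' : 0 < (1 : ℂ).re := by simp
  set F : ℕ → ℝ → ℂ := fun n x =>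
    1 / 2 * (rising (1 / 2) n / rising 1 n) * betaIntegrand (1 / 2 + n) 1 x
  have hi (n : ℕ) : IntervalIntegrable (betaIntegrand (1 / 2 + n) 1) MeasureTheory.volume 0 1 :=
    intervalIntegrable_betaIntegrand (add_natCast_re_pos hh n) h1' h0 h1
  have hterm (n : ℕ) : secondTerm 0 n = rising (1 / 2) n / rising 1 n *
      (rising (1 / 2) n / rising (1 / 2 + 1) n) := by
    rw [secondTerm, show (3 / 2 - 0 : ℂ) = 1 / 2 + 1 by norm_num, mul_zero, zero_add, zero_add, sq,
      mul_div_mul_comm]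
  have hB : betaIntegral (1 / 2) 1 = 2 := by
    rw [betaIntegral_eval_one_right hh]; norm_num
  have hint (n : ℕ) : ∫ x : ℝ in 0..1, F n x = secondTerm 0 n := by
    have e := betaIntegral_add_natCast hh h1' n 0
    simp only [Nat.cast_zero, add_zero, rising_zero, mul_one, hB] at e
    rw [intervalIntegral.integral_const_mul, hterm]
    change _ * betaIntegral (1 / 2 + n) 1 = _
    rw [e]
    ring
  have hnorm (n : ℕ) : ∫ x : ℝ in 0..1, ‖F n x‖ = ‖secondTerm 0 n‖ := by
    have e := integral_norm_betaIntegrand_eq hh h1' n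
    simp only [F, norm_mul]
    rw [intervalIntegral.integral_const_mul, e, hterm, norm_mul]
    have a1 : ((1 / 2 : ℂ).re : ℂ) = 1 / 2 := by norm_num
    have a2 : ((1 : ℂ).re : ℂ) = 1 := by norm_num
    rw [a1, a2, hB]
    norm_num
    ring
  have hs := summable_secondTerm (a := 0) (by norm_num) (two_mul_ne_of_re_gt (by norm_num))
  have key : HasSum (fun n => ∫ x : ℝ in 0..1, F n x) (∫ x : ℝ in 0..1, ∑' n, F n x) := by
    have hn := hs.norm
    simp_rw [← hnorm] at hn
    simp only [intervalIntegral.integral_of_le (zero_le_one' ℝ)] at hn ⊢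
    exact MeasureTheory.hasSum_integral_of_summable_integral_norm
      (fun n => (intervalIntegrable_iff_integrableOn_Ioc_of_le zero_le_one).1
        ((hi n).const_mul _)) hn
  have hlim : ∫ x : ℝ in 0..1, ∑' n, F n x = (Real.pi : ℂ) / 2 := by
    have e : ∫ x : ℝ in 0..1, ∑' n, F n x =
        ∫ x : ℝ in 0..1, 1 / 2 * betaIntegrand (1 / 2) (1 / 2) x := by
      rw [intervalIntegral.integral_of_le zero_le_one, intervalIntegral.integral_of_le zero_le_one,
        MeasureTheory.integral_Ioc_eq_integral_Ioo, MeasureTheory.integral_Ioc_eq_integral_Ioo]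
      refine MeasureTheory.setIntegral_congr_fun measurableSet_Ioo fun x hx => ?_
      have hx0 : (x : ℂ) ≠ 0 := ofReal_ne_zero.2 hx.1.ne'
      have h := ((hasSum_rising_half_mul_pow hx).mul_left (1 / 2 * (x : ℂ) ^ (1 / 2 - 1 : ℂ)))
      refine (h.congr_fun fun n => ?_).tsum_eq.trans ?_
      · simp only [F, betaIntegrand, sub_self, cpow_zero, mul_one]
        rw [show (1 / 2 : ℂ) + n - 1 = 1 / 2 - 1 + n by ring, cpow_add _ _ hx0, cpow_natCast]
        ring
      · simp only [betaIntegrand]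
        norm_num
        ring
    rw [e, intervalIntegral.integral_const_mul]
    change _ * betaIntegral (1 / 2) (1 / 2) = _
    have g := Gamma_half_add_mul_Gamma_half_sub 0
    rw [add_zero, sub_zero, mul_zero, cos_zero, div_one] at g
    rw [betaIntegral_eq_Gamma hh hh, g]
    norm_num
    ring
  rw [hlim] at key
  simp only [hint] at key
  exact key.tsum_eq

/-! ### Two-jets at 0 and the derivatives of f -/

/-- `f` is analytic at `0` with value `c₀` and first two derivatives `c₁`, `c₂` there. -/
structure HasTwoJet (f : ℂ → ℂ) (c₀ c₁ c₂ : ℂ) : Prop where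
  analyticAt : AnalyticAt ℂ f 0
  value : f 0 = c₀
  deriv_one : deriv f 0 = c₁
  deriv_two : deriv (deriv f) 0 = c₂

namespace HasTwoJet

theorem congr {f g : ℂ → ℂ} {c₀ c₁ c₂ : ℂ} (hf : HasTwoJet f c₀ c₁ c₂) (h : f =ᶠ[𝓝 0] g) :
    HasTwoJet g c₀ c₁ c₂ :=
  ⟨hf.analyticAt.congr h, h.eq_of_nhds ▸ hf.value, h.deriv_eq ▸ hf.deriv_one,
    h.deriv.deriv_eq ▸ hf.deriv_two⟩

theorem of_analyticAt {f : ℂ → ℂ} (hf : AnalyticAt ℂ f 0) :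
    HasTwoJet f (f 0) (deriv f 0) (deriv (deriv f) 0) := ⟨hf, rfl, rfl, rfl⟩

theorem add {f g : ℂ → ℂ} {a₀ a₁ a₂ b₀ b₁ b₂ : ℂ} (hf : HasTwoJet f a₀ a₁ a₂)
    (hg : HasTwoJet g b₀ b₁ b₂) :
    HasTwoJet (fun x => f x + g x) (a₀ + b₀) (a₁ + b₁) (a₂ + b₂) := by
  have hd : deriv (fun x => f x + g x) =ᶠ[𝓝 0] fun x => deriv f x + deriv g x := by
    filter_upwards [hf.analyticAt.eventually_analyticAt, hg.analyticAt.eventually_analyticAt]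
      with x hx hy
    exact deriv_fun_add hx.differentiableAt hy.differentiableAt
  refine ⟨hf.analyticAt.fun_add hg.analyticAt, by rw [hf.value, hg.value], ?_, ?_⟩
  · rw [hd.eq_of_nhds, hf.deriv_one, hg.deriv_one]
  · rw [hd.deriv_eq, deriv_fun_add hf.analyticAt.deriv.differentiableAt
      hg.analyticAt.deriv.differentiableAt, hf.deriv_two, hg.deriv_two]

theorem mul {f g : ℂ → ℂ} {a₀ a₁ a₂ b₀ b₁ b₂ : ℂ} (hf : HasTwoJet f a₀ a₁ a₂)
    (hg : HasTwoJet g b₀ b₁ b₂) :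
    HasTwoJet (fun x => f x * g x) (a₀ * b₀) (a₁ * b₀ + a₀ * b₁)
      (a₂ * b₀ + 2 * a₁ * b₁ + a₀ * b₂) := by
  have hd : deriv (fun x => f x * g x) =ᶠ[𝓝 0] fun x => deriv f x * g x + f x * deriv g x := by
    filter_upwards [hf.analyticAt.eventually_analyticAt, hg.analyticAt.eventually_analyticAt]
      with x hx hy
    exact deriv_fun_mul hx.differentiableAt hy.differentiableAt
  refine ⟨hf.analyticAt.fun_mul hg.analyticAt, by rw [hf.value, hg.value], ?_, ?_⟩
  · rw [hd.eq_of_nhds, hf.deriv_one, hg.deriv_one, hf.value, hg.value]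
  · have f1 := hf.analyticAt.differentiableAt
    have g1 := hg.analyticAt.differentiableAt
    have f2 := hf.analyticAt.deriv.differentiableAt
    have g2 := hg.analyticAt.deriv.differentiableAt
    rw [hd.deriv_eq, deriv_fun_add (f2.fun_mul g1) (f1.fun_mul g2), deriv_fun_mul f2 g1,
      deriv_fun_mul f1 g2, hf.deriv_two, hg.deriv_two, hf.deriv_one, hg.deriv_one, hf.value,
      hg.value]
    ring

theorem comp_const_mul {f : ℂ → ℂ} {c₀ c₁ c₂ : ℂ} (hf : HasTwoJet f c₀ c₁ c₂) (r : ℂ) :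
    HasTwoJet (fun x => f (r * x)) c₀ (r * c₁) (r ^ 2 * c₂) := by
  have hd (f : ℂ → ℂ) : deriv (fun x => f (r * x)) = fun x => r * deriv f (r * x) := by
    ext x
    simpa using deriv_comp_mul_left r f x
  refine ⟨?_, by simpa using hf.value, ?_, ?_⟩
  · have h : AnalyticAt ℂ f (r * 0) := by simpa using hf.analyticAt
    exact h.comp (f := fun x => r * x) (by fun_prop)
  · simp only [hd, mul_zero, hf.deriv_one]
  · rw [hd, deriv_const_mul_field, hd]
    simp only [mul_zero, hf.deriv_two]
    ring

theorem const (c : ℂ) : HasTwoJet (fun _ => c) c 0 0 := by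
  refine ⟨analyticAt_const, rfl, by simp, by simp⟩

theorem id : HasTwoJet (fun x => x) 0 1 0 := by
  refine ⟨analyticAt_id, rfl, by simp, by simp⟩

end HasTwoJet

theorem hasTwoJet_cos (r : ℂ) : HasTwoJet (fun x => cos (r * x)) 1 0 (-r ^ 2) := by
  have h : HasTwoJet cos 1 0 (-1) := by
    refine ⟨analyticAt_cos, cos_zero, by simp, ?_⟩
    rw [Complex.deriv_cos']
    simp
  simpa using h.comp_const_mul r

/-- The entire function equal to `sin (π a) / a` away from `0`. -/
noncomputable def sinPiDiv (a : ℂ) : ℂ := Real.pi * ((Gamma (1 + a))⁻¹ * (Gamma (1 - a))⁻¹)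

theorem mul_sinPiDiv {a : ℂ} (ha : ‖a‖ < 1) : a * sinPiDiv a = sin (Real.pi * a) := by
  rcases eq_or_ne a 0 with rfl | h0
  · simp
  have hre := (abs_lt.1 ((abs_re_le_norm a).trans_lt ha))
  have h1 : Gamma (1 + a) ≠ 0 := Gamma_ne_zero_of_re_pos (by simp; linarith)
  have h2 : Gamma (1 - a) ≠ 0 := Gamma_ne_zero_of_re_pos (by simp; linarith)
  have h := Gamma_mul_Gamma_one_sub a
  have hpi : (Real.pi : ℂ) ≠ 0 := ofReal_ne_zero.2 Real.pi_ne_zero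
  have e : Gamma (1 + a) = a * Gamma a := by rw [add_comm, Gamma_add_one a h0]
  rw [e] at h1
  have hs : sin (Real.pi * a) ≠ 0 := by
    intro hs
    rw [hs, div_zero] at h
    exact mul_ne_zero (right_ne_zero_of_mul h1) h2 h
  rw [sinPiDiv, e, mul_inv, mul_assoc, ← mul_inv, h]
  field_simp

theorem differentiable_sinPiDiv : Differentiable ℂ sinPiDiv := by
  have h := differentiable_one_div_Gamma
  exact ((h.comp (f := fun a => 1 + a) (by fun_prop)).mul
    (h.comp (f := fun a => 1 - a) (by fun_prop))).const_mul _

/-- With S this function, differentiating a S(a) = sin(πa) gives S + a S' = π cos(πa). The two-jet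
of the left side at 0 is S(0), 2S'(0), 3S''(0); the third derivative of S is killed by the factor a.
-/
theorem hasTwoJet_sinPiDiv : HasTwoJet sinPiDiv Real.pi 0 (-(Real.pi : ℂ) ^ 3 / 3) := by
  have han : AnalyticAt ℂ sinPiDiv 0 := differentiable_sinPiDiv.analyticAt 0
  have hJ := HasTwoJet.of_analyticAt han
  have hJ' := HasTwoJet.of_analyticAt han.deriv
  have h1 := hJ.add (HasTwoJet.id.mul hJ')
  have hev : (fun a => sin (Real.pi * a)) =ᶠ[𝓝 0] fun a => a * sinPiDiv a := by
    filter_upwards [Metric.ball_mem_nhds (0 : ℂ) one_pos] with a ha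
    exact (mul_sinPiDiv (by simpa using ha)).symm
  have hd : (fun a => sinPiDiv a + a * deriv sinPiDiv a) =ᶠ[𝓝 0]
      fun a => Real.pi * cos (Real.pi * a) := by
    filter_upwards [hev.deriv] with a ha
    have e : deriv (fun a => sin (Real.pi * a)) a = Real.pi * cos (Real.pi * a) := by
      have := deriv_comp_mul_left (Real.pi : ℂ) sin a
      simpa using this
    rw [e, deriv_fun_mul differentiableAt_fun_id (differentiable_sinPiDiv a)] at ha
    simpa using ha.symm
  have h2 := (HasTwoJet.const (Real.pi : ℂ)).mul (hasTwoJet_cos Real.pi)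
  have h3 := h1.congr hd
  have v0 := h3.value.symm.trans h2.value
  have v1 := h3.deriv_one.symm.trans h2.deriv_one
  have v2 := h3.deriv_two.symm.trans h2.deriv_two
  refine ⟨han, by linear_combination v0, by linear_combination v1 / 2, ?_⟩
  linear_combination v2 / 3

/-- The powers of 64 cancel and reflection removes every Gamma value, so the even part of the
logarithm of the Gamma term is elementary near 0. -/
theorem gammaPart_mul_gammaPart_neg {a : ℂ} (ha : ‖a‖ < 1 / 2) :
    gammaPart a * gammaPart (-a) *
      (sinPiDiv a * (sinPiDiv a * sinPiDiv a) * cos (Real.pi * a)) = 256 * Real.pi := by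
  have hre := (abs_lt.1 ((abs_re_le_norm a).trans_lt ha))
  have h1 : Gamma (1 + a) ≠ 0 := Gamma_ne_zero_of_re_pos (by simp; linarith)
  have h2 : Gamma (1 - a) ≠ 0 := Gamma_ne_zero_of_re_pos (by simp; linarith)
  have h3 : Gamma (1 / 2 + a) ≠ 0 := Gamma_ne_zero_of_re_pos (by norm_num; linarith)
  have h4 : Gamma (1 / 2 - a) ≠ 0 := Gamma_ne_zero_of_re_pos (by norm_num; linarith)
  have hpi : (Real.pi : ℂ) ≠ 0 := ofReal_ne_zero.2 Real.pi_ne_zero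
  have hr := Gamma_half_add_mul_Gamma_half_sub a
  have hc : cos (Real.pi * a) ≠ 0 := by
    intro h
    rw [h, div_zero] at hr
    exact mul_ne_zero h3 h4 hr
  have h64 : (64 : ℂ) ^ a ≠ 0 := by simp [cpow_eq_zero_iff]
  have hg : Gamma (1 / 2) * Gamma (1 / 2) = Real.pi := by
    have := Gamma_half_add_mul_Gamma_half_sub 0
    simpa using this
  have hg0 : Gamma (1 / 2) ≠ 0 := Gamma_ne_zero_of_re_pos (by norm_num)
  simp only [gammaPart, risingGamma, sinPiDiv, Gamma_one, div_one, ← sub_eq_add_neg, mul_neg,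
    cos_neg, cpow_neg]
  generalize cos (Real.pi * a) = c at *
  generalize (64 : ℂ) ^ a = T at *
  generalize Gamma (1 / 2) = g at *
  rw [← hg] at hr ⊢
  generalize Gamma (1 / 2 + a) = G at *
  generalize Gamma (1 / 2 - a) = K at *
  generalize Gamma (1 + a) = L at *
  generalize Gamma (1 - a) = M at *
  have hK : K = g * g / (c * G) := by
    field_simp
    field_simp at hr
    linear_combination hr
  rw [hK]
  field_simp
  ring

/-- Euler's constant cancels between Γ'/Γ at 1 and at 1/2, leaving 6 log 2. The power 64^a adds
another 6 log 2, the squared cosine adds nothing, and 16/π · 12 log 2 results. -/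
theorem deriv_gammaPart_zero :
    HasDerivAt gammaPart (192 / (Real.pi : ℂ) * (Real.log 2 : ℂ)) 0 := by
  have g1 : HasDerivAt (fun a => risingGamma 1 a) (-(Real.eulerMascheroniConstant : ℂ)) 0 := by
    have h : HasDerivAt Gamma (-(Real.eulerMascheroniConstant : ℂ)) (1 + 0) := by
      simpa using hasDerivAt_Gamma_one
    have := h.comp_const_add 1 0
    simpa [risingGamma] using this
  have hg0 : Gamma (1 / 2) ≠ 0 := Gamma_ne_zero_of_re_pos (by norm_num)
  have g2 : HasDerivAt (fun a => risingGamma (1 / 2) a)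
      (-(Real.eulerMascheroniConstant + 2 * Real.log 2) : ℂ) 0 := by
    have h : HasDerivAt Gamma (-√Real.pi * (Real.eulerMascheroniConstant + 2 * Real.log 2))
        (1 / 2 + 0) := by
      have := hasDerivAt_Gamma_one_half
      simpa using this
    have := (h.comp_const_add (1 / 2) 0).div_const (Gamma (1 / 2))
    refine this.congr_deriv ?_
    have hpi : Gamma (1 / 2) = (√Real.pi : ℝ) := by
      rw [Gamma_one_half_eq, Real.sqrt_eq_rpow, ofReal_cpow Real.pi_pos.le]; norm_num
    rw [hpi] at hg0 ⊢
    field_simp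
  have r1 : risingGamma 1 0 = 1 := by simp [risingGamma]
  have r2 : risingGamma (1 / 2) 0 = 1 := by rw [risingGamma, add_zero, div_self hg0]
  have hp : HasDerivAt (fun a : ℂ => (64 : ℂ) ^ a) (6 * Real.log 2) 0 := by
    have := (hasDerivAt_id (0 : ℂ)).const_cpow (c := 64) (Or.inl (by norm_num))
    refine this.congr_deriv ?_
    have h : (64 : ℂ) = ((2 : ℝ) ^ 6 : ℝ) := by norm_num
    rw [h, ← ofReal_log (by positivity), Real.log_pow]
    push_cast
    simp
  have hc : HasDerivAt (fun a : ℂ => cos (Real.pi * a)) 0 0 := by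
    have := ((hasDerivAt_id (0 : ℂ)).const_mul (Real.pi : ℂ)).ccos
    simpa using this
  have hc0 : cos ((Real.pi : ℂ) * 0) ^ 2 ≠ 0 := by simp
  have h := ((hp.fun_div (hc.fun_pow 2) hc0).const_mul (16 / (Real.pi : ℂ))).fun_mul
    ((g1.fun_pow 3).fun_div (g2.fun_pow 3) (by rw [r2]; simp))
  refine h.congr_deriv ?_
  rw [r1, r2]
  simp
  ring

theorem analyticAt_of_forall_differentiableAt {f : ℂ → ℂ}
    (hf : ∀ a : ℂ, a.re < 1 / 2 → (∀ m : ℕ, 2 * a ≠ -((m : ℂ) + 1)) → DifferentiableAt ℂ f a) :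
    AnalyticAt ℂ f 0 := by
  rw [analyticAt_iff_eventually_differentiableAt]
  filter_upwards [Metric.ball_mem_nhds (0 : ℂ) (by norm_num : (0 : ℝ) < 1 / 2)] with a ha
  rw [mem_ball_zero_iff] at ha
  have hre := (abs_lt.1 ((abs_re_le_norm a).trans_lt ha))
  exact hf a hre.2 (two_mul_ne_of_re_gt (by linarith))

theorem hasTwoJet_gammaPart : HasTwoJet gammaPart (16 / (Real.pi : ℂ))
    (192 / (Real.pi : ℂ) * (Real.log 2 : ℂ))
    (2304 / (Real.pi : ℂ) * (Real.log 2 : ℂ) ^ 2 + 16 * Real.pi) := by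
  have han : AnalyticAt ℂ gammaPart 0 :=
    analyticAt_of_forall_differentiableAt fun _ => differentiableAt_gammaPart
  have hJ : HasTwoJet gammaPart _ _ _ :=
    ⟨han, gammaPart_zero, deriv_gammaPart_zero.deriv, rfl⟩
  have hN := hJ.comp_const_mul (-1)
  have hS := hasTwoJet_sinPiDiv
  have hP := (hJ.mul hN).mul ((hS.mul (hS.mul hS)).mul (hasTwoJet_cos Real.pi))
  have hev : (fun a => gammaPart a * gammaPart (-1 * a) *
      (sinPiDiv a * (sinPiDiv a * sinPiDiv a) * cos (Real.pi * a))) =ᶠ[𝓝 0]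
        fun _ => 256 * (Real.pi : ℂ) := by
    filter_upwards [Metric.ball_mem_nhds (0 : ℂ) (by norm_num : (0 : ℝ) < 1 / 2)] with a ha
    rw [neg_one_mul]
    exact gammaPart_mul_gammaPart_neg (by simpa using ha)
  have h2 := (hP.congr hev).deriv_two.symm.trans (HasTwoJet.const _).deriv_two
  have hpi : (Real.pi : ℂ) ≠ 0 := ofReal_ne_zero.2 Real.pi_ne_zero
  refine ⟨han, gammaPart_zero, deriv_gammaPart_zero.deriv, ?_⟩
  generalize deriv (deriv gammaPart) 0 = d at *
  generalize (Real.log 2 : ℂ) = l at *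
  generalize (Real.pi : ℂ) = π at *
  -- The second derivative of the constant product is 0. In that relation g''(0) has coefficient 2 ·
  -- (16/π) · π³ = 32π².
  linear_combination (norm := (field_simp; ring)) 1 / (32 * π ^ 2) * h2

theorem hasTwoJet_ramanujanF : HasTwoJet ramanujanF (16 / (Real.pi : ℂ))
    (192 / (Real.pi : ℂ) * (Real.log 2 : ℂ))
    (16 / (Real.pi : ℂ) * (144 * (Real.log 2 : ℂ) ^ 2 - 7 * (Real.pi : ℂ) ^ 2)) := by
  set k : ℂ → ℂ := fun a => 128 / (2 * a - 1) * ∑' n, secondTerm a n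
  have hk : AnalyticAt ℂ k 0 := by
    refine analyticAt_of_forall_differentiableAt fun a ha h => DifferentiableAt.fun_mul ?_
      (differentiableAt_tsum_secondTerm ha h)
    exact DifferentiableAt.fun_div (by fun_prop) (by fun_prop) (two_mul_sub_one_ne_zero ha)
  have hk0 : k 0 = -64 * Real.pi := by
    simp only [k, tsum_secondTerm_zero]
    norm_num
    ring
  -- The correction a² k(a) contributes only 2k(0) = −128π, to the second derivative; with 16π from
  -- the Gamma term this gives −112π.
  have h := hasTwoJet_gammaPart.add
    ((HasTwoJet.id.mul HasTwoJet.id).mul (HasTwoJet.of_analyticAt hk))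
  have hev : (fun a => gammaPart a + a * a * k a) =ᶠ[𝓝 0] ramanujanF := by
    filter_upwards [Metric.ball_mem_nhds (0 : ℂ) (by norm_num : (0 : ℝ) < 1 / 2)] with a ha
    rw [mem_ball_zero_iff] at ha
    have hre := (abs_lt.1 ((abs_re_le_norm a).trans_lt ha))
    rw [ramanujanF_eq_gammaPart_add hre.2 (two_mul_ne_of_re_gt (by linarith))]
    simp only [k]
    ring
  have hpi : (Real.pi : ℂ) ≠ 0 := ofReal_ne_zero.2 Real.pi_ne_zero
  have h' := h.congr hev
  refine ⟨h'.analyticAt, h'.value.trans ?_, h'.deriv_one.trans ?_, h'.deriv_two.trans ?_⟩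
  · ring
  · ring
  · rw [hk0]
    field_simp
    ring

end

theorem mainTheorem2 :
    -- the series `f(a)` converges wherever its terms are defined
    (∀ a : ℂ, (∀ m : ℕ, a ≠ -((m : ℂ) + 1)) → Summable (ramanujanTerm a)) ∧
    -- first identity
    (∀ a : ℂ, 0 < a.re →
      Summable (firstTerm a) ∧ ramanujanF a = 32 * a * ∑' n : ℕ, firstTerm a n) ∧
    -- second identity
    (∀ a : ℂ, a.re < 1 / 2 → (∀ m : ℕ, 2 * a ≠ -((m : ℂ) + 1)) →
      Summable (secondTerm a) ∧
      ramanujanF a =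
        16 / (Real.pi : ℂ) * ((64 : ℂ) ^ a / Complex.cos ((Real.pi : ℂ) * a) ^ 2)
            * (risingGamma 1 a ^ 3 / risingGamma (1 / 2) a ^ 3)
          + 128 * a ^ 2 / (2 * a - 1) * ∑' n : ℕ, secondTerm a n) ∧
    -- evaluations
    ramanujanF (1 / 2) = 8 * (Real.pi : ℂ) ^ 2 / 3 ∧
    ramanujanF 0 = 16 / (Real.pi : ℂ) ∧
    AnalyticAt ℂ ramanujanF 0 ∧
    deriv ramanujanF 0 = 192 / (Real.pi : ℂ) * (Real.log 2 : ℂ) ∧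
    deriv (deriv ramanujanF) 0 =
      16 / (Real.pi : ℂ) * (144 * (Real.log 2 : ℂ) ^ 2 - 7 * (Real.pi : ℂ) ^ 2) := by
  have hJ := hasTwoJet_ramanujanF
  exact ⟨fun a ha => summable_ramanujanTerm ha,
    fun a ha => ⟨summable_firstTerm ha, ramanujanF_eq_tsum_firstTerm ha⟩,
    fun a ha h => ⟨summable_secondTerm ha h, ramanujanF_eq_gammaPart_add ha h⟩,
    ramanujanF_one_half, ramanujanF_zero, hJ.analyticAt, hJ.deriv_one, hJ.deriv_two⟩
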